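/- Let $n,q\ge 1$ be integers, let $\nu$ be a probability measure on a measurable space $\Xi$, and let $F:\mathbb R^n\times\Xi\to\mathbb R$ be such that $F(x,\cdot)\in L^1(\nu)$ for every $x\in\mathbb R^n$ and $F(\cdot,\xi)$ is Lipschitz continuous with constant $L_0$ (for the Euclidean norm) for every $\xi\in\Xi$. Put $f(x)=\mathbb E_{\xi\sim\nu}[F(x,\xi)]$ and, for $\beta>0$, $f^\beta(x)=\mathbb E_{u\sim\mathcal N(0,I_n)}[f(x+\beta u)]$. Consider the iterates of the ZO-Signum algorithm: from (possibly random) $x^0,m^0\in\mathbb R^n$, for $k=0,1,2,\dots$, $$g^k=\frac1q\sum_{j=1}^q\frac{F(x^k+\beta u^{k,j},\xi^{k,j})-F(x^k,\xi^{k,j})}{\beta}\,u^{k,j},\qquad m^{k+1}=s_2^k g^k+(1-s_2^k)m^k,\qquad x^{k+1}_j=x^k_j-s_1^k\,\mathrm{sign}(m^{k+1}_j)\ \ (1\le j\le n),$$ where the pairs $(u^{k,j},\xi^{k,j})$ are i.i.d. with law $\mathcal N(0,I_n)\otimes\nu$ and independent of $(x^0,m^0)$, and where $$s_1^k=\frac{n^{-3/4}}{(k+1)^{3/4}},\qquad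 s_2^k=\frac{s_2^0}{(k+1)^{1/2}}.$$ Let $L_0\ge 0$, $D,B\in\mathbb R$, $b>0$, $\sigma>0$ and $C\in\mathbb N$. There is a constant $A>0$, depending only on $L_0,D,B,b,\sigma,C$ (in particular not on $n$, $q$, $F$, $\nu$ or $K$), such that the following holds whenever $\beta\ge b$ and $\sigma\le s_2^0\le 1$ (that is, $\beta$ and $s_2^0$ are of order one), $\mathbb E\|m^0\|_2\le Bn$, and $f^{\beta}(x^{C})-\inf f^{\beta}\le D$ almost surely. The function $f^\beta$ is differentiable, and for every integer $K\ge 2$ with $K>C$, if $R$ is uniformly distributed on $\{C,C+1,\dots,K\}$ and independent of $(x^0,m^0)$ and of all the samples, then $$\mathbb E\big[\|\nabla f^{\beta}(x^{R})\|_2\big]\le A\,\frac{n^{3/2}\ln K}{K^{1/4}},$$ i.e. $\mathbb E[\|\nabla f^{\beta}(x^{R})\|_2]=O\big(n^{3/2}\ln K/K^{1/4}\big)$. -/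

import Mathlib

open MeasureTheory ProbabilityTheory
open scoped NNReal Gradient

noncomputable section

namespace ZOSignum

/-- The objective `f(x) = 𝔼_ξ[F(x, ξ)]` of the stochastic blackbox `F`, with `ξ` of law `ν`. -/
def objective {n : ℕ} {Ξ : Type*} [MeasurableSpace Ξ] (ν : Measure Ξ)
    (F : EuclideanSpace ℝ (Fin n) → Ξ → ℝ) (x : EuclideanSpace ℝ (Fin n)) : ℝ :=
  ∫ ξ, F x ξ ∂ν

/-- The Gaussian smoothing `f^β(x) = 𝔼_u[f(x + β u)]`, `u` standard Gaussian in `ℝⁿ`. -/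
def smoothing {n : ℕ} (f : EuclideanSpace ℝ (Fin n) → ℝ) (β : ℝ)
    (x : EuclideanSpace ℝ (Fin n)) : ℝ :=
  ∫ u, f (x + β • u) ∂(stdGaussian (EuclideanSpace ℝ (Fin n)))

/-- The one-sided mini-batch Gaussian gradient estimator
`(1/q) ∑ⱼ uʲ (F(x + β uʲ, ξʲ) - F(x, ξʲ)) / β`. -/
def gradEstimate {n q : ℕ} {Ξ : Type*} (F : EuclideanSpace ℝ (Fin n) → Ξ → ℝ) (β : ℝ)
    (x : EuclideanSpace ℝ (Fin n)) (u : Fin q → EuclideanSpace ℝ (Fin n)) (ξ : Fin q → Ξ) :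
    EuclideanSpace ℝ (Fin n) :=
  (1 / (q : ℝ)) • ∑ j, ((F (x + β • u j) (ξ j) - F x (ξ j)) / β) • u j

/-- The step size sequence `s / (k + 1)^α`. -/
def stepSize (s α : ℝ) (k : ℕ) : ℝ := s / ((k : ℝ) + 1) ^ α

/-- The pair `(x^k, m^k)` of the ZO-Signum recursion started at `(x₀, m₀)` with step size
sequences `s₁`, `s₂` and with the samples `u k j`, `ξ k j` (`j < q`) drawn at iteration `k`:
`m^{k+1} = s₂^k g^k + (1 - s₂^k) m^k` and `x_j^{k+1} = x_j^k - s₁^k sign(m_j^{k+1})`. -/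
def iterate {n q : ℕ} {Ξ : Type*} (F : EuclideanSpace ℝ (Fin n) → Ξ → ℝ) (β : ℝ)
    (s₁ s₂ : ℕ → ℝ) (x₀ m₀ : EuclideanSpace ℝ (Fin n))
    (u : ℕ → Fin q → EuclideanSpace ℝ (Fin n)) (ξ : ℕ → Fin q → Ξ) :
    ℕ → EuclideanSpace ℝ (Fin n) × EuclideanSpace ℝ (Fin n)
  | 0 => (x₀, m₀)
  | k + 1 =>
    let x := (iterate F β s₁ s₂ x₀ m₀ u ξ k).1
    let m := (iterate F β s₁ s₂ x₀ m₀ u ξ k).2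
    let m' := s₂ k • gradEstimate F β x (u k) (ξ k) + (1 - s₂ k) • m
    (WithLp.toLp 2 fun j => x j - s₁ k * Real.sign (m' j), m')

end ZOSignum

end

noncomputable section

namespace ZOSignum

open scoped RealInnerProductSpace

variable {n q : ℕ}

/-! ### Standard Gaussian: Cameron–Martin, Stein's identity, moments -/

section Gaussian

/-! Write `h` for the gradient of the smoothed objective. By Stein's identity, `h` is the mean of
the one-sample estimator. It is bounded by `L₀` and Lipschitz with constant `L₁ = L₀ n / β`,
although the blackbox itself need not be differentiable.

The descent inequality along a sign step (`smoothing_le_add_inner`, `inner_signStep_sub_le`) gives a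
decrease of `s₁ ‖h(x^k)‖`, up to `2 √n s₁ ‖m^{k+1} - h(x^k)‖` and `L₁ n s₁²`. What remains is to
control how far the momentum is from the gradient. That error splits into an accumulated noise
`M^k`, driven by `g^k - h(x^k)` and started at zero, and a remainder `m^k - h(x^k) - M^k`. The
remainder contracts along each path by `1 - s₂^k`, up to the drift `L₁ √n s₁^k` of the gradient. The
noise contracts in mean square up to `(s₂^k)²` times the variance of a batch, of order `n²`, because
the estimator is unbiased and the state is independent of the fresh samples
(`integral_sq_norm_momentumNoise_succ_le`).

With `r_k = (k+1)^{1/4}`, the steps are of order `r_k⁻³` and `r_k⁻²`. Weighted telescoping then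
turns every error into a multiple of `∑ r_k⁻⁴`, a harmonic sum, hence the logarithm
(`mul_sum_norm_le_of_signum`). Taking expectations and dividing by the smallest step gives a sum of
expected gradient norms of order `n^{3/2} K^{3/4} ln K`; averaging over the uniform index divides by
an order of `K`. -/

lemma integrable_exp_mul_norm_stdGaussian (c : ℝ) :
    Integrable (fun u : EuclideanSpace ℝ (Fin n) => Real.exp (c * ‖u‖))
      (stdGaussian (EuclideanSpace ℝ (Fin n))) := by
  -- Fernique's theorem; completing the square dominates the linear exponent by the quadratic one.
  obtain ⟨a, ha, hInt⟩ :=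
    IsGaussian.exists_integrable_exp_sq (stdGaussian (EuclideanSpace ℝ (Fin n)))
  refine (hInt.const_mul (Real.exp (c ^ 2 / (4 * a)))).mono' (by fun_prop) (.of_forall fun u => ?_)
  rw [Real.norm_eq_abs, abs_of_pos (Real.exp_pos _), ← Real.exp_add]
  refine Real.exp_le_exp.2 ?_
  have h : c ^ 2 / (4 * a) + a * ‖u‖ ^ 2 - c * ‖u‖ = a * (‖u‖ - c / (2 * a)) ^ 2 := by
    field_simp; ring
  nlinarith [mul_nonneg ha.le (sq_nonneg (‖u‖ - c / (2 * a)))]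

lemma integrable_exp_inner_stdGaussian (a : EuclideanSpace ℝ (Fin n)) (c : ℝ) :
    Integrable (fun u : EuclideanSpace ℝ (Fin n) => Real.exp (⟪a, u⟫ - c))
      (stdGaussian (EuclideanSpace ℝ (Fin n))) := by
  refine ((integrable_exp_mul_norm_stdGaussian ‖a‖).const_mul (Real.exp (-c))).mono' (by fun_prop)
    (.of_forall fun u => ?_)
  rw [Real.norm_eq_abs, abs_of_pos (Real.exp_pos _), ← Real.exp_add]
  exact Real.exp_le_exp.2 (by linarith [real_inner_le_norm a u])

lemma integral_exp_mul_gaussianReal (z : ℂ) :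
    ∫ x : ℝ, Complex.exp (z * x) ∂(gaussianReal 0 1) = Complex.exp (z ^ 2 / 2) := by
  have h := complexMGF_id_gaussianReal (μ := 0) (v := 1) z
  simpa [complexMGF] using h

/-- The Cameron–Martin formula for the standard Gaussian. -/
lemma map_add_const_stdGaussian (a : EuclideanSpace ℝ (Fin n)) :
    (stdGaussian (EuclideanSpace ℝ (Fin n))).map (fun u => u + a) =
      (stdGaussian (EuclideanSpace ℝ (Fin n))).withDensity
        (fun u => ENNReal.ofReal (Real.exp (⟪a, u⟫ - ‖a‖ ^ 2 / 2))) := by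
  have : IsFiniteMeasure ((stdGaussian (EuclideanSpace ℝ (Fin n))).withDensity
        (fun u => ENNReal.ofReal (Real.exp (⟪a, u⟫ - ‖a‖ ^ 2 / 2)))) :=
    isFiniteMeasure_withDensity_ofReal (integrable_exp_inner_stdGaussian a _).2
  -- Both measures are finite, so characteristic functions decide; they factor over coordinates into
  -- one-dimensional Gaussian integrals with the complex exponents `a i + t i * I`.
  apply Measure.ext_of_charFun
  ext t
  rw [charFun_map_add_const, charFun_stdGaussian, charFun_apply,
    integral_withDensity_eq_integral_toReal_smul (by fun_prop) (by simp)]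
  simp_rw [ENNReal.toReal_ofReal (Real.exp_pos _).le]
  rw [← map_pi_eq_stdGaussian, integral_map (by fun_prop)
    (Continuous.aestronglyMeasurable (by fun_prop))]
  have key : ∀ v : Fin n → ℝ,
      Real.exp (⟪a, WithLp.toLp 2 v⟫ - ‖a‖ ^ 2 / 2) •
        Complex.exp (((⟪WithLp.toLp 2 v, t⟫ : ℝ) : ℂ) * Complex.I) =
      Complex.exp (-(‖a‖ : ℂ) ^ 2 / 2) *
        ∏ i, Complex.exp (((a i : ℂ) + t i * Complex.I) * (v i : ℂ)) := by
    intro v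
    rw [← Complex.exp_sum, ← Complex.exp_add, Complex.real_smul, Complex.ofReal_exp,
      ← Complex.exp_add]
    congr 1
    simp only [PiLp.inner_apply, RCLike.inner_apply, conj_trivial]
    push_cast
    simp only [add_mul, Finset.sum_add_distrib, Finset.sum_mul]
    have e1 : ∀ i, (v i : ℂ) * (a i) = a i * v i := fun i => by ring
    have e2 : ∀ i, (t i : ℂ) * (v i) * Complex.I = t i * Complex.I * v i := fun i => by ring
    simp only [e1, e2]
    ring
  simp_rw [key]
  rw [integral_const_mul,
    integral_fintype_prod_eq_prod
      (f := fun i (x : ℝ) => Complex.exp (((a i : ℂ) + t i * Complex.I) * (x : ℂ)))]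
  simp_rw [integral_exp_mul_gaussianReal]
  rw [← Complex.exp_sum, ← Complex.exp_add, ← Complex.exp_add]
  congr 1
  have ha : (‖a‖ : ℂ) ^ 2 = ∑ i, (a i : ℂ) ^ 2 := by
    exact_mod_cast congrArg (fun r : ℝ => (r : ℂ)) (EuclideanSpace.real_norm_sq_eq a)
  have ht : (‖t‖ : ℂ) ^ 2 = ∑ i, (t i : ℂ) ^ 2 := by
    exact_mod_cast congrArg (fun r : ℝ => (r : ℂ)) (EuclideanSpace.real_norm_sq_eq t)
  rw [ha, ht]
  simp only [PiLp.inner_apply, RCLike.inner_apply, conj_trivial]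
  push_cast
  have e : ∀ i, ((a i : ℂ) + t i * Complex.I) ^ 2 / 2 =
      (a i : ℂ) ^ 2 / 2 - (t i : ℂ) ^ 2 / 2 + t i * a i * Complex.I := fun i => by
    linear_combination (t i : ℂ) ^ 2 / 2 * Complex.I_sq
  simp only [e, Finset.sum_add_distrib, Finset.sum_sub_distrib, ← Finset.sum_div, ← Finset.sum_mul]
  ring

lemma integral_comp_add_stdGaussian {f : EuclideanSpace ℝ (Fin n) → ℝ} (hf : Continuous f)
    (a : EuclideanSpace ℝ (Fin n)) :
    ∫ u, f (u + a) ∂(stdGaussian (EuclideanSpace ℝ (Fin n))) =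
      ∫ u, Real.exp (⟪a, u⟫ - ‖a‖ ^ 2 / 2) * f u
        ∂(stdGaussian (EuclideanSpace ℝ (Fin n))) := by
  rw [← integral_map (φ := fun u => u + a) (f := f) (by fun_prop) hf.aestronglyMeasurable,
    map_add_const_stdGaussian, integral_withDensity_eq_integral_toReal_smul (by fun_prop) (by simp)]
  simp [ENNReal.toReal_ofReal (Real.exp_pos _).le]

lemma _root_.LipschitzWith.abs_le_add_mul_norm {E : Type*} [SeminormedAddCommGroup E] {L : ℝ≥0}
    {f : E → ℝ} (hf : LipschitzWith L f) (u : E) : |f u| ≤ |f 0| + L * ‖u‖ := by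
  have h := hf.dist_le_mul u 0
  rw [Real.dist_eq, dist_zero_right] at h
  linarith [abs_sub_abs_le_abs_sub (f u) (f 0)]

lemma integrable_lipschitz_stdGaussian {L : ℝ≥0} {f : EuclideanSpace ℝ (Fin n) → ℝ}
    (hf : LipschitzWith L f) : Integrable f (stdGaussian (EuclideanSpace ℝ (Fin n))) := by
  refine ((integrable_const |f 0|).add (IsGaussian.integrable_id.norm.const_mul (L : ℝ))).mono'
    hf.continuous.aestronglyMeasurable (.of_forall fun u => ?_)
  simpa using hf.abs_le_add_mul_norm u

lemma integrable_norm_pow_stdGaussian (k : ℕ) :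
    Integrable (fun u : EuclideanSpace ℝ (Fin n) => ‖u‖ ^ k)
      (stdGaussian (EuclideanSpace ℝ (Fin n))) := by
  by_cases hk : k = 0
  · simp [hk]
  · simpa using (IsGaussian.memLp_id (stdGaussian (EuclideanSpace ℝ (Fin n))) k
      (by simp)).integrable_norm_pow hk

/-- The gradient of the Gaussian smoothing of a Lipschitz function (Stein's identity). -/
lemma hasFDerivAt_integral_comp_add_stdGaussian {L : ℝ≥0} {f : EuclideanSpace ℝ (Fin n) → ℝ}
    (hf : LipschitzWith L f) :
    HasFDerivAt (fun a => ∫ u, f (u + a) ∂(stdGaussian (EuclideanSpace ℝ (Fin n))))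
      (innerSL ℝ (∫ u, f u • u ∂(stdGaussian (EuclideanSpace ℝ (Fin n))))) 0 := by
  have hcont := hf.continuous
  -- Cameron–Martin moves the shift from `f`, which is only Lipschitz, to a smooth density, so that
  -- differentiation under the integral is possible.
  simp_rw [integral_comp_add_stdGaussian hcont]
  have hexp : ∀ s : ℝ, 0 ≤ s → s + 1 ≤ Real.exp s := fun s _ => Real.add_one_le_exp s
  have hInt : Integrable (fun u => f u • u) (stdGaussian (EuclideanSpace ℝ (Fin n))) := by
    refine ((integrable_norm_pow_stdGaussian 1).const_mul |f 0| |>.add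
      ((integrable_norm_pow_stdGaussian 2).const_mul (L : ℝ))).mono'
      (Continuous.aestronglyMeasurable (by fun_prop)) (.of_forall fun u => ?_)
    rw [norm_smul, Real.norm_eq_abs]
    have := mul_le_mul_of_nonneg_right (hf.abs_le_add_mul_norm u) (norm_nonneg u)
    simp only [Pi.add_apply]
    nlinarith
  have := hasFDerivAt_integral_of_dominated_of_fderiv_le (𝕜 := ℝ)
    (μ := stdGaussian (EuclideanSpace ℝ (Fin n))) (x₀ := (0 : EuclideanSpace ℝ (Fin n)))
    (F := fun a u => Real.exp (⟪a, u⟫ - ‖a‖ ^ 2 / 2) * f u)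
    (F' := fun a u => (Real.exp (⟪a, u⟫ - ‖a‖ ^ 2 / 2) * f u) • innerSL ℝ (u - a))
    -- On the unit ball the density, `|f u| / (|f 0| + L)` and `‖u - a‖` are each at most `exp ‖u‖`,
    -- up to a vanishing denominator.
    (bound := fun u => (|f 0| + L) * Real.exp (3 * ‖u‖))
    (s := Metric.ball 0 1) (Metric.ball_mem_nhds _ one_pos)
    (.of_forall fun a => Continuous.aestronglyMeasurable (by fun_prop))
    (by simpa using integrable_lipschitz_stdGaussian hf)
    (Continuous.aestronglyMeasurable (by fun_prop))
    (.of_forall fun u a ha => ?_) ((integrable_exp_mul_norm_stdGaussian 3).const_mul _)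
    (.of_forall fun u a ha => ?_)
  · refine this.congr_fderiv ?_
    rw [← ContinuousLinearMap.integral_comp_comm _ hInt]
    simp
  · rw [mem_ball_zero_iff] at ha
    rw [norm_smul, innerSL_apply_norm, norm_mul, Real.norm_eq_abs, Real.norm_eq_abs,
      abs_of_pos (Real.exp_pos _)]
    have h1 : Real.exp (⟪a, u⟫ - ‖a‖ ^ 2 / 2) ≤ Real.exp ‖u‖ := by
      refine Real.exp_le_exp.2 ?_
      nlinarith [real_inner_le_norm a u, norm_nonneg u, sq_nonneg ‖a‖]
    have h2 : |f u| ≤ (|f 0| + L) * Real.exp ‖u‖ := by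
      refine (hf.abs_le_add_mul_norm u).trans ?_
      have := hexp ‖u‖ (norm_nonneg u)
      nlinarith [abs_nonneg (f 0), L.coe_nonneg, norm_nonneg u,
        mul_le_mul_of_nonneg_left this (add_nonneg (abs_nonneg (f 0)) L.coe_nonneg),
        mul_nonneg (abs_nonneg (f 0)) (norm_nonneg u)]
    have h3 : ‖u - a‖ ≤ Real.exp ‖u‖ := by
      linarith [norm_sub_le u a, hexp ‖u‖ (norm_nonneg u)]
    calc _ ≤ Real.exp ‖u‖ * ((|f 0| + L) * Real.exp ‖u‖) * Real.exp ‖u‖ := by gcongr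
      _ = (|f 0| + L) * Real.exp (3 * ‖u‖) := by
        rw [show 3 * ‖u‖ = ‖u‖ + ‖u‖ + ‖u‖ by ring, Real.exp_add, Real.exp_add]; ring
  · have h1 : HasFDerivAt (fun a : EuclideanSpace ℝ (Fin n) => ⟪a, u⟫ - ‖a‖ ^ 2 / 2)
        (innerSL ℝ (u - a)) a := by
      have e1 : HasFDerivAt (fun a : EuclideanSpace ℝ (Fin n) => ⟪a, u⟫) (innerSL ℝ u) a := by
        simpa [real_inner_comm] using (innerSL ℝ u).hasFDerivAt (x := a)
      have e2 := (hasStrictFDerivAt_norm_sq a).hasFDerivAt.mul_const (1 / 2 : ℝ)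
      refine ((e1.sub e2).congr_fderiv ?_).congr_of_eventuallyEq (.of_forall fun b => ?_)
      · ext b; simp
      · simp only [Pi.sub_apply]; ring
    refine (h1.exp.mul_const (f u)).congr_fderiv ?_
    rw [smul_smul, mul_comm]

lemma measurePreserving_apply_stdGaussian (i : Fin n) :
    MeasurePreserving (fun u : EuclideanSpace ℝ (Fin n) => u i)
      (stdGaussian (EuclideanSpace ℝ (Fin n))) (gaussianReal 0 1) := by
  refine ⟨by fun_prop, ?_⟩
  rw [← map_pi_eq_stdGaussian, Measure.map_map (by fun_prop) (by fun_prop)]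
  exact (measurePreserving_eval (fun _ : Fin n => gaussianReal 0 1) i).map_eq

lemma integral_apply_pow_stdGaussian (i : Fin n) (k : ℕ) :
    ∫ u : EuclideanSpace ℝ (Fin n), u i ^ k ∂(stdGaussian (EuclideanSpace ℝ (Fin n))) =
      ∫ x, x ^ k ∂(gaussianReal 0 1) := by
  rw [← (measurePreserving_apply_stdGaussian i).map_eq, integral_map (by fun_prop) (by fun_prop)]

lemma integrable_apply_pow_stdGaussian (i : Fin n) (k : ℕ) :
    Integrable (fun u : EuclideanSpace ℝ (Fin n) => u i ^ k)
      (stdGaussian (EuclideanSpace ℝ (Fin n))) := by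
  refine (integrable_norm_pow_stdGaussian k).mono' (by fun_prop) (.of_forall fun u => ?_)
  rw [norm_pow]
  exact pow_le_pow_left₀ (norm_nonneg _) (PiLp.norm_apply_le u i) k

lemma integral_norm_sq_stdGaussian :
    ∫ u, ‖u‖ ^ 2 ∂(stdGaussian (EuclideanSpace ℝ (Fin n))) = n := by
  simp_rw [EuclideanSpace.real_norm_sq_eq]
  rw [integral_finsetSum _ fun i _ => integrable_apply_pow_stdGaussian i 2]
  have h := variance_id_gaussianReal (μ := 0) (v := 1)
  rw [variance_of_integral_eq_zero (by fun_prop) (by simp)] at h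
  simp only [integral_apply_pow_stdGaussian]
  simp_all

lemma integral_norm_stdGaussian_le (hn : 1 ≤ n) :
    ∫ u, ‖u‖ ∂(stdGaussian (EuclideanSpace ℝ (Fin n))) ≤ n := by
  have h1 : (1 : ℝ) ≤ n := by exact_mod_cast hn
  calc ∫ u, ‖u‖ ∂(stdGaussian (EuclideanSpace ℝ (Fin n)))
      ≤ ∫ u, (1 / 2 + 1 / 2 * ‖u‖ ^ 2) ∂(stdGaussian (EuclideanSpace ℝ (Fin n))) := by
        refine integral_mono (by simpa using integrable_norm_pow_stdGaussian (n := n) 1)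
          ((integrable_const _).add ((integrable_norm_pow_stdGaussian 2).const_mul _)) fun u => ?_
        simp only
        nlinarith [sq_nonneg (‖u‖ - 1)]
    _ = 1 / 2 + 1 / 2 * n := by
        rw [integral_add (integrable_const _) ((integrable_norm_pow_stdGaussian 2).const_mul _),
          integral_const_mul, integral_norm_sq_stdGaussian]
        simp
    _ ≤ n := by linarith

/-- Cauchy–Schwarz over the coordinates. The scalar fourth moment is left unevaluated: it only
enters the final constant. -/
lemma integral_norm_pow_four_stdGaussian_le :
    ∫ u, ‖u‖ ^ 4 ∂(stdGaussian (EuclideanSpace ℝ (Fin n))) ≤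
      (∫ x, x ^ 4 ∂(gaussianReal 0 1)) * n ^ 2 := by
  calc ∫ u, ‖u‖ ^ 4 ∂(stdGaussian (EuclideanSpace ℝ (Fin n)))
      ≤ ∫ u : EuclideanSpace ℝ (Fin n), n * ∑ i, u i ^ 4
          ∂(stdGaussian (EuclideanSpace ℝ (Fin n))) := by
        refine integral_mono (integrable_norm_pow_stdGaussian 4)
          ((integrable_finsetSum _ fun i _ => integrable_apply_pow_stdGaussian i 4).const_mul _)
          fun u => ?_
        have h := sq_sum_le_card_mul_sum_sq (s := Finset.univ) (f := fun i => u i ^ 2)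
        rw [← EuclideanSpace.real_norm_sq_eq, Finset.card_univ, Fintype.card_fin] at h
        simpa only [← pow_mul] using h
    _ = _ := by
        rw [integral_const_mul, integral_finsetSum _ fun i _ => integrable_apply_pow_stdGaussian i 4]
        simp only [integral_apply_pow_stdGaussian, Finset.sum_const, Finset.card_univ,
          Fintype.card_fin, nsmul_eq_mul]
        ring

end Gaussian

/-! ### Gradient and smoothness of the Gaussian smoothing -/

section Smoothing

variable {L : ℝ≥0} {f : EuclideanSpace ℝ (Fin n) → ℝ} {β : ℝ}

lemma lipschitzWith_comp_add_smul (hf : LipschitzWith L f) (β : ℝ)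
    (x : EuclideanSpace ℝ (Fin n)) :
    LipschitzWith (L * ‖β‖₊) fun u : EuclideanSpace ℝ (Fin n) => f (x + β • u) :=
  LipschitzWith.of_dist_le_mul fun u v => by
    refine (hf.dist_le_mul _ _).trans_eq ?_
    rw [dist_add_left, dist_smul₀]
    push_cast
    ring

lemma integrable_smoothing_smul (hf : LipschitzWith L f) (β : ℝ)
    (x : EuclideanSpace ℝ (Fin n)) :
    Integrable (fun u => f (x + β • u) • u) (stdGaussian (EuclideanSpace ℝ (Fin n))) := by
  have hg := lipschitzWith_comp_add_smul hf β x
  have hc := hg.continuous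
  refine ((integrable_norm_pow_stdGaussian 1).const_mul |f (x + β • 0)| |>.add
    ((integrable_norm_pow_stdGaussian 2).const_mul ((L * ‖β‖₊ : ℝ≥0) : ℝ))).mono'
    (Continuous.aestronglyMeasurable (hc.smul continuous_id)) (.of_forall fun u => ?_)
  rw [norm_smul, Real.norm_eq_abs]
  have := mul_le_mul_of_nonneg_right (hg.abs_le_add_mul_norm u) (norm_nonneg u)
  simp only [Pi.add_apply]
  nlinarith

lemma lipschitzWith_smoothing (hf : LipschitzWith L f) (β : ℝ) :
    LipschitzWith L (smoothing f β) :=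
  LipschitzWith.of_dist_le_mul fun x y => by
    have hx := integrable_lipschitz_stdGaussian (lipschitzWith_comp_add_smul hf β x)
    have hy := integrable_lipschitz_stdGaussian (lipschitzWith_comp_add_smul hf β y)
    rw [dist_eq_norm, smoothing, smoothing, ← integral_sub hx hy]
    refine (norm_integral_le_of_norm_le_const (C := L * dist x y) (.of_forall fun u => ?_)).trans_eq
      (by simp)
    rw [← dist_eq_norm]
    exact (hf.dist_le_mul _ _).trans_eq (by rw [dist_add_right])

lemma hasGradientAt_smoothing (hf : LipschitzWith L f) (hβ : β ≠ 0)
    (x : EuclideanSpace ℝ (Fin n)) :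
    HasGradientAt (smoothing f β)
      (β⁻¹ • ∫ u, f (x + β • u) • u ∂(stdGaussian (EuclideanSpace ℝ (Fin n)))) x := by
  have h := hasFDerivAt_integral_comp_add_stdGaussian (lipschitzWith_comp_add_smul hf β x)
  -- A move of the base point is a shift of the Gaussian variable: `y + β u = x + β (u + (y - x) /
  -- β)`.
  have h0 : HasFDerivAt (fun y : EuclideanSpace ℝ (Fin n) => β⁻¹ • (y - x))
      (β⁻¹ • ContinuousLinearMap.id ℝ (EuclideanSpace ℝ (Fin n))) x :=
    ((hasFDerivAt_id x).sub_const x).const_smul β⁻¹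
  have e : β⁻¹ • (x - x) = (0 : EuclideanSpace ℝ (Fin n)) := by simp
  rw [← e] at h
  rw [hasGradientAt_iff_hasFDerivAt]
  refine ((h.comp x h0).congr_fderiv ?_).congr_of_eventuallyEq (.of_forall fun y => ?_)
  · ext v
    simp
  · simp only [smoothing, Function.comp_apply, smul_add, smul_smul, mul_inv_cancel₀ hβ, one_smul]
    congr 1
    ext u
    congr 1
    abel

lemma gradient_smoothing (hf : LipschitzWith L f) (hβ : β ≠ 0) (x : EuclideanSpace ℝ (Fin n)) :
    ∇ (smoothing f β) x =
      β⁻¹ • ∫ u, f (x + β • u) • u ∂(stdGaussian (EuclideanSpace ℝ (Fin n))) :=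
  (hasGradientAt_smoothing hf hβ x).gradient

lemma differentiable_smoothing (hf : LipschitzWith L f) (hβ : β ≠ 0) :
    Differentiable ℝ (smoothing f β) :=
  fun x => (hasGradientAt_smoothing hf hβ x).differentiableAt

/-- Subtracting `f x` is free because `u` has mean zero; this is the form taken by the estimator. -/
lemma gradient_smoothing_eq_integral_sub (hf : LipschitzWith L f) (hβ : β ≠ 0)
    (x : EuclideanSpace ℝ (Fin n)) :
    ∇ (smoothing f β) x =
      ∫ u, ((f (x + β • u) - f x) / β) • u ∂(stdGaussian (EuclideanSpace ℝ (Fin n))) := by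
  have e : ∀ u : EuclideanSpace ℝ (Fin n),
      ((f (x + β • u) - f x) / β) • u = β⁻¹ • (f (x + β • u) • u) - (β⁻¹ * f x) • u := fun u => by
    rw [smul_smul, ← sub_smul]; congr 1; ring
  simp_rw [e]
  rw [integral_sub ((integrable_smoothing_smul hf β x).fun_smul _)
    (IsGaussian.integrable_fun_id.fun_smul (β⁻¹ * f x)), integral_smul, integral_smul,
    integral_id_stdGaussian, smul_zero, sub_zero, gradient_smoothing hf hβ]

lemma norm_gradient_smoothing_le (hf : LipschitzWith L f) (β : ℝ)
    (x : EuclideanSpace ℝ (Fin n)) : ‖∇ (smoothing f β) x‖ ≤ L := by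
  rw [gradient, LinearIsometryEquiv.norm_map]
  exact norm_fderiv_le_of_lipschitz ℝ (lipschitzWith_smoothing hf β)

/-- In Stein's formula the point enters only through values of `f`, so the Lipschitz bound on `f`
and `E‖u‖ ≤ n` suffice. A constant of order `n` instead of `√n` does not worsen the final rate. -/
lemma norm_gradient_smoothing_sub_le (hn : 1 ≤ n) (hf : LipschitzWith L f) (hβ : 0 < β)
    (x y : EuclideanSpace ℝ (Fin n)) :
    ‖∇ (smoothing f β) x - ∇ (smoothing f β) y‖ ≤ L * n / β * ‖x - y‖ := by
  rw [gradient_smoothing hf hβ.ne', gradient_smoothing hf hβ.ne', ← smul_sub,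
    ← integral_sub (integrable_smoothing_smul hf β x) (integrable_smoothing_smul hf β y),
    norm_smul, Real.norm_eq_abs, abs_of_pos (inv_pos.2 hβ)]
  have h : ‖∫ u, (f (x + β • u) • u - f (y + β • u) • u)
      ∂(stdGaussian (EuclideanSpace ℝ (Fin n)))‖ ≤
      ∫ u, L * ‖x - y‖ * ‖u‖ ∂(stdGaussian (EuclideanSpace ℝ (Fin n))) := by
    refine norm_integral_le_of_norm_le (IsGaussian.integrable_fun_id.norm.const_mul _)
      (.of_forall fun u => ?_)
    rw [← sub_smul, norm_smul]
    refine mul_le_mul_of_nonneg_right ?_ (norm_nonneg u)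
    rw [← dist_eq_norm, ← dist_eq_norm]
    exact (hf.dist_le_mul _ _).trans_eq (by rw [dist_add_right])
  rw [integral_const_mul] at h
  calc _ ≤ β⁻¹ * (L * ‖x - y‖ * n) := by
        refine mul_le_mul_of_nonneg_left (h.trans ?_) (inv_pos.2 hβ).le
        exact mul_le_mul_of_nonneg_left (integral_norm_stdGaussian_le hn) (by positivity)
    _ = _ := by ring

lemma continuous_gradient_smoothing (hn : 1 ≤ n) (hf : LipschitzWith L f) (hβ : 0 < β) :
    Continuous (∇ (smoothing f β)) := by
  refine (LipschitzWith.of_dist_le_mul (K := (L * n / β).toNNReal) fun x y => ?_).continuous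
  rw [dist_eq_norm, dist_eq_norm, Real.coe_toNNReal _ (by positivity)]
  exact norm_gradient_smoothing_sub_le hn hf hβ x y

/-- The descent inequality for the smoothing. -/
lemma smoothing_le_add_inner (hn : 1 ≤ n) (hf : LipschitzWith L f) (hβ : 0 < β)
    (x y : EuclideanSpace ℝ (Fin n)) :
    smoothing f β y ≤
      smoothing f β x + ⟪∇ (smoothing f β) x, y - x⟫ + L * n / β * ‖y - x‖ ^ 2 := by
  have h := (convex_segment x y).norm_image_sub_le_of_norm_hasFDerivWithin_le'
    (f := smoothing f β) (φ := InnerProductSpace.toDual ℝ _ (∇ (smoothing f β) x))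
    (f' := fun z => InnerProductSpace.toDual ℝ _ (∇ (smoothing f β) z))
    (C := L * n / β * ‖y - x‖)
    (fun z _ => (differentiable_smoothing hf hβ.ne' z).hasGradientAt.hasFDerivAt.hasFDerivWithinAt)
    (fun z hz => by
      rw [← map_sub, LinearIsometryEquiv.norm_map]
      refine (norm_gradient_smoothing_sub_le hn hf hβ z x).trans ?_
      refine mul_le_mul_of_nonneg_left ?_ (by positivity)
      obtain ⟨t, ht, rfl⟩ := (segment_eq_image' ℝ x y ▸ hz :)
      rw [add_sub_cancel_left, norm_smul, Real.norm_eq_abs, abs_of_nonneg ht.1]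
      exact mul_le_of_le_one_left (norm_nonneg _) ht.2)
    (left_mem_segment ℝ x y) (right_mem_segment ℝ x y)
  rw [InnerProductSpace.toDual_apply_apply, Real.norm_eq_abs] at h
  linarith [(abs_le.1 h).2, sq ‖y - x‖]

end Smoothing

/-! ### Unbiasedness of the one-sample estimator -/

section Objective

lemma norm_finiteDifference_smul_le {Ξ : Type*} {L : ℝ≥0} {F : EuclideanSpace ℝ (Fin n) → Ξ → ℝ}
    {β : ℝ} (hL : ∀ ξ, LipschitzWith L fun x => F x ξ) (hβ : 0 < β)
    (x u : EuclideanSpace ℝ (Fin n)) (ξ : Ξ) :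
    ‖((F (x + β • u) ξ - F x ξ) / β) • u‖ ≤ L * ‖u‖ ^ 2 := by
  have h := (hL ξ).dist_le_mul (x + β • u) x
  rw [Real.dist_eq, dist_self_add_left, norm_smul, Real.norm_eq_abs, abs_of_pos hβ] at h
  rw [norm_smul, Real.norm_eq_abs, abs_div, abs_of_pos hβ]
  have : |F (x + β • u) ξ - F x ξ| / β ≤ L * ‖u‖ := by
    rw [div_le_iff₀ hβ]; linarith
  calc _ ≤ L * ‖u‖ * ‖u‖ := mul_le_mul_of_nonneg_right this (norm_nonneg u)
    _ = _ := by ring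

variable {Ξ : Type*} [MeasurableSpace Ξ] {ν : Measure Ξ} [IsProbabilityMeasure ν] {L : ℝ≥0}
  {F : EuclideanSpace ℝ (Fin n) → Ξ → ℝ} {β : ℝ}

lemma lipschitzWith_objective (hi : ∀ x, Integrable (F x) ν)
    (hL : ∀ ξ, LipschitzWith L fun x => F x ξ) : LipschitzWith L (objective ν F) :=
  LipschitzWith.of_dist_le_mul fun x y => by
    rw [dist_eq_norm, objective, objective, ← integral_sub (hi x) (hi y)]
    refine (norm_integral_le_of_norm_le_const (C := L * dist x y) (.of_forall fun ξ => ?_)).trans_eq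
      (by simp)
    rw [← dist_eq_norm]
    exact (hL ξ).dist_le_mul _ _

lemma measurable_uncurry_blackbox (hm : ∀ x, Measurable (F x))
    (hL : ∀ ξ, LipschitzWith L fun x => F x ξ) : Measurable (Function.uncurry F) :=
  measurable_uncurry_of_continuous_of_measurable (fun ξ => (hL ξ).continuous) hm

lemma measurable_finiteDifference_smul (hm : ∀ x, Measurable (F x))
    (hL : ∀ ξ, LipschitzWith L fun x => F x ξ) (β : ℝ) :
    Measurable fun p : EuclideanSpace ℝ (Fin n) × EuclideanSpace ℝ (Fin n) × Ξ =>
      ((F (p.1 + β • p.2.1) p.2.2 - F p.1 p.2.2) / β) • p.2.1 := by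
  have h := measurable_uncurry_blackbox hm hL
  have h1 : Measurable fun p : EuclideanSpace ℝ (Fin n) × EuclideanSpace ℝ (Fin n) × Ξ =>
      F (p.1 + β • p.2.1) p.2.2 := h.comp (by fun_prop : Measurable fun
        p : EuclideanSpace ℝ (Fin n) × EuclideanSpace ℝ (Fin n) × Ξ => (p.1 + β • p.2.1, p.2.2))
  have h2 : Measurable fun p : EuclideanSpace ℝ (Fin n) × EuclideanSpace ℝ (Fin n) × Ξ =>
      F p.1 p.2.2 := h.comp (by fun_prop : Measurable fun
        p : EuclideanSpace ℝ (Fin n) × EuclideanSpace ℝ (Fin n) × Ξ => (p.1, p.2.2))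
  exact ((h1.sub h2).div_const β).smul (by fun_prop)

lemma integrable_finiteDifference_smul (hm : ∀ x, Measurable (F x))
    (hL : ∀ ξ, LipschitzWith L fun x => F x ξ) (hβ : 0 < β) (x : EuclideanSpace ℝ (Fin n)) :
    Integrable (fun p : EuclideanSpace ℝ (Fin n) × Ξ =>
      ((F (x + β • p.1) p.2 - F x p.2) / β) • p.1)
      ((stdGaussian (EuclideanSpace ℝ (Fin n))).prod ν) := by
  refine (((integrable_norm_pow_stdGaussian 2).comp_fst ν).const_mul (L : ℝ)).mono'
    ((measurable_finiteDifference_smul hm hL β).comp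
      (measurable_const.prodMk measurable_id)).aestronglyMeasurable
    (.of_forall fun p => norm_finiteDifference_smul_le hL hβ x p.1 p.2)

/-- The one-sample estimator is an unbiased estimator of the gradient of the smoothing. -/
lemma integral_finiteDifference_smul (hm : ∀ x, Measurable (F x)) (hi : ∀ x, Integrable (F x) ν)
    (hL : ∀ ξ, LipschitzWith L fun x => F x ξ) (hβ : 0 < β) (x : EuclideanSpace ℝ (Fin n)) :
    ∫ p : EuclideanSpace ℝ (Fin n) × Ξ, ((F (x + β • p.1) p.2 - F x p.2) / β) • p.1
      ∂((stdGaussian (EuclideanSpace ℝ (Fin n))).prod ν) =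
      ∇ (smoothing (objective ν F) β) x := by
  rw [integral_prod _ (integrable_finiteDifference_smul hm hL hβ x),
    gradient_smoothing_eq_integral_sub (lipschitzWith_objective hi hL) hβ.ne']
  refine integral_congr_ae (.of_forall fun u => ?_)
  simp only
  rw [integral_smul_const, integral_div, integral_sub (hi _) (hi _)]
  rfl

end Objective

/-! ### Pathwise analysis of sign momentum -/

section Deterministic

/-- Weighted telescoping for a sequence that contracts up to an error. -/
lemma sum_mul_le_of_contraction {d w s c δ : ℕ → ℝ} (hd : ∀ k, 0 ≤ d k) (hw : Antitone w)
    (hw0 : ∀ k, 0 ≤ w k) (hc : ∀ k, c k ≤ w k * s k)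
    (h : ∀ k, d (k + 1) ≤ (1 - s k) * d k + δ k) (N : ℕ) :
    ∑ k ∈ Finset.range N, c k * d k ≤ w 0 * d 0 + ∑ k ∈ Finset.range N, w k * δ k := by
  suffices ∑ k ∈ Finset.range N, c k * d k + w N * d N ≤
      w 0 * d 0 + ∑ k ∈ Finset.range N, w k * δ k by
    linarith [mul_nonneg (hw0 N) (hd N)]
  induction N with
  | zero => simp
  | succ N ih =>
    rw [Finset.sum_range_succ, Finset.sum_range_succ]
    have h1 : w (N + 1) * d (N + 1) ≤ w N * d (N + 1) :=
      mul_le_mul_of_nonneg_right (hw N.le_succ) (hd _)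
    have h2 := mul_le_mul_of_nonneg_left (h N) (hw0 N)
    have h3 := mul_le_mul_of_nonneg_right (hc N) (hd N)
    linarith

/-- Telescoping bounds `∑ s k * a k`; passing to `a (k + 1)`, the index at which the momentum is
used, costs one more `V * ∑ s k ^ 2`, hence the factor 2. -/
lemma sum_mul_succ_le_of_contraction {a s : ℕ → ℝ} {V : ℝ} (ha : ∀ k, 0 ≤ a k)
    (hs0 : ∀ k, 0 ≤ s k) (hs1 : ∀ k, s k ≤ 1) (hV : 0 ≤ V)
    (h : ∀ k, a (k + 1) ≤ (1 - s k) * a k + s k ^ 2 * V) (N : ℕ) :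
    ∑ k ∈ Finset.range N, s k * a (k + 1) ≤
      a 0 + 2 * V * ∑ k ∈ Finset.range N, s k ^ 2 := by
  have h1 := sum_mul_le_of_contraction (w := fun _ => 1) (c := s) ha antitone_const
    (fun _ => zero_le_one) (fun k => by simp) h N
  have h2 : ∑ k ∈ Finset.range N, s k * a (k + 1) ≤
      ∑ k ∈ Finset.range N, (s k * a k + s k ^ 2 * V) := by
    refine Finset.sum_le_sum fun k _ => ?_
    have e1 := mul_le_mul_of_nonneg_left (h k) (hs0 k)
    have e2 : 0 ≤ s k ^ 2 * V := by positivity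
    nlinarith [mul_le_mul_of_nonneg_right (hs1 k) e2, mul_nonneg (sq_nonneg (s k)) (ha k)]
  rw [Finset.sum_add_distrib] at h2
  have e : ∑ k ∈ Finset.range N, s k ^ 2 * V = V * ∑ k ∈ Finset.range N, s k ^ 2 := by
    rw [← Finset.sum_mul, mul_comm]
  simp only [one_mul] at h1
  linarith

/-- If the sign of `b` is wrong or zero, then `|a - b|` is at least `|a|`. -/
lemma sub_two_mul_abs_sub_le_mul_sign (a b : ℝ) : |a| - 2 * |a - b| ≤ a * Real.sign b := by
  rcases lt_trichotomy b 0 with hb | hb | hb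
  · rw [Real.sign_of_neg hb]
    rcases abs_cases a with ⟨h, _⟩ | ⟨h, _⟩ <;> rcases abs_cases (a - b) with ⟨h', _⟩ | ⟨h', _⟩ <;>
      rw [h, h'] <;> linarith
  · rw [hb, Real.sign_zero, sub_zero]
    linarith [abs_nonneg a]
  · rw [Real.sign_of_pos hb]
    rcases abs_cases a with ⟨h, _⟩ | ⟨h, _⟩ <;> rcases abs_cases (a - b) with ⟨h', _⟩ | ⟨h', _⟩ <;>
      rw [h, h'] <;> linarith

lemma norm_le_sum_abs (a : EuclideanSpace ℝ (Fin n)) : ‖a‖ ≤ ∑ i, |a i| := by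
  refine abs_le_of_sq_le_sq' ?_ (by positivity) |>.2
  rw [EuclideanSpace.real_norm_sq_eq]
  simpa [sq_abs] using
    Finset.sum_sq_le_sq_sum_of_nonneg (s := Finset.univ) (f := fun i => |a i|) (by simp)

lemma sum_abs_le_sqrt_mul_norm (a : EuclideanSpace ℝ (Fin n)) :
    ∑ i, |a i| ≤ √n * ‖a‖ := by
  refine abs_le_of_sq_le_sq' ?_ (by positivity) |>.2
  rw [mul_pow, Real.sq_sqrt (by positivity), EuclideanSpace.real_norm_sq_eq]
  simpa [sq_abs] using sq_sum_le_card_mul_sum_sq (s := Finset.univ) (f := fun i => |a i|)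

/-- One step of the sign update. -/
def signStep (s : ℝ) (x m : EuclideanSpace ℝ (Fin n)) : EuclideanSpace ℝ (Fin n) :=
  WithLp.toLp 2 fun j => x j - s * Real.sign (m j)

/-- The sign step decreases at the rate of the ℓ¹ norm of `h`, which dominates the Euclidean one;
the ℓ¹ norm of the error costs `√n`. -/
lemma inner_signStep_sub_le {s : ℝ} (hs : 0 ≤ s) (h x m : EuclideanSpace ℝ (Fin n)) :
    ⟪h, signStep s x m - x⟫ ≤ -s * ‖h‖ + 2 * √n * s * ‖m - h‖ := by
  have e : ⟪h, signStep s x m - x⟫ = -s * ∑ i, h i * Real.sign (m i) := by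
    simp only [PiLp.inner_apply, RCLike.inner_apply, conj_trivial, signStep, PiLp.sub_apply,
      Finset.mul_sum]
    refine Finset.sum_congr rfl fun i _ => ?_
    ring
  have h1 : ∑ i, |h i| - 2 * ∑ i, |(m - h) i| ≤ ∑ i, h i * Real.sign (m i) := by
    rw [Finset.mul_sum, ← Finset.sum_sub_distrib]
    refine Finset.sum_le_sum fun i _ => ?_
    rw [PiLp.sub_apply, abs_sub_comm]
    exact sub_two_mul_abs_sub_le_mul_sign _ _
  have h2 := norm_le_sum_abs h
  have h3 := sum_abs_le_sqrt_mul_norm (m - h)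
  rw [e]
  have h4 : ‖h‖ - 2 * (√n * ‖m - h‖) ≤ ∑ i, h i * Real.sign (m i) := by linarith
  nlinarith [mul_le_mul_of_nonneg_left h4 hs]

lemma norm_signStep_sub_le {s : ℝ} (hs : 0 ≤ s) (x m : EuclideanSpace ℝ (Fin n)) :
    ‖signStep s x m - x‖ ≤ √n * s := by
  refine abs_le_of_sq_le_sq' ?_ (by positivity) |>.2
  rw [mul_pow, Real.sq_sqrt (by positivity), EuclideanSpace.real_norm_sq_eq]
  calc ∑ i, (signStep s x m - x) i ^ 2 ≤ ∑ _i : Fin n, s ^ 2 := by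
        refine Finset.sum_le_sum fun i _ => ?_
        have : (signStep s x m - x) i = -(s * Real.sign (m i)) := by
          simp [signStep]
        rw [this, neg_sq, mul_pow]
        refine mul_le_of_le_one_right (sq_nonneg s) ?_
        rcases Real.sign_apply_eq (m i) with h | h | h <;> rw [h] <;> norm_num
    _ = _ := by simp

/-- Pathwise bound on the weighted sum of the gradient norms along a sign momentum recursion, in
terms of the accumulated noise `M`. -/
lemma mul_sum_norm_le_of_signum {φ : EuclideanSpace ℝ (Fin n) → ℝ}
    {h : EuclideanSpace ℝ (Fin n) → EuclideanSpace ℝ (Fin n)} {L L₁ t σ s₂ D : ℝ}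
    (hn : 1 ≤ n) (ht : 0 ≤ t) (hσ : 0 < σ) (hσs : σ ≤ s₂) (hs₂ : s₂ ≤ 1) (hL₁ : 0 ≤ L₁)
    (hh : ∀ y, ‖h y‖ ≤ L) (hlip : ∀ y z, ‖h y - h z‖ ≤ L₁ * ‖y - z‖)
    (hdesc : ∀ y z, φ z ≤ φ y + ⟪h y, z - y⟫ + L₁ * ‖z - y‖ ^ 2)
    {r : ℕ → ℝ} (hr1 : ∀ k, 1 ≤ r k) (hrmono : Monotone r)
    {x m M g : ℕ → EuclideanSpace ℝ (Fin n)}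
    (hm : ∀ k, m (k + 1) = (s₂ / r k ^ 2) • g k + (1 - s₂ / r k ^ 2) • m k)
    (hx : ∀ k, x (k + 1) = signStep (t / r k ^ 3) (x k) (m (k + 1)))
    (hM0 : M 0 = 0)
    (hM : ∀ k, M (k + 1) = (1 - s₂ / r k ^ 2) • M k + (s₂ / r k ^ 2) • (g k - h (x k)))
    {C K : ℕ} (hCK : C ≤ K) (hD : ∀ y, φ (x C) - φ y ≤ D) :
    t / r K ^ 3 * ∑ k ∈ Finset.Icc C K, ‖h (x k)‖ ≤
      D + 2 * √n * t * ((‖m 0‖ + L + L₁ * √n * t * ∑ k ∈ Finset.range (K + 1), 1 / r k ^ 4) / σ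
        + n / 2 * ∑ k ∈ Finset.range (K + 1), 1 / r k ^ 4
        + 1 / (2 * n) * ∑ k ∈ Finset.range (K + 1), 1 / r k ^ 2 * ‖M (k + 1)‖ ^ 2)
      + L₁ * n * t ^ 2 * ∑ k ∈ Finset.range (K + 1), 1 / r k ^ 4 := by
  have hn' : (1 : ℝ) ≤ n := by exact_mod_cast hn
  have hr0 : ∀ k, 0 < r k := fun k => one_pos.trans_le (hr1 k)
  set H := ∑ k ∈ Finset.range (K + 1), 1 / r k ^ 4 with hH
  have hs0 : 0 ≤ s₂ := hσ.le.trans hσs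
  have hα0 : ∀ k, 0 ≤ s₂ / r k ^ 2 := fun k => div_nonneg hs0 (pow_pos (hr0 k) 2).le
  have hα1 : ∀ k, s₂ / r k ^ 2 ≤ 1 := fun k =>
    div_le_one_of_le₀ (hs₂.trans (one_le_pow₀ (hr1 k))) (pow_pos (hr0 k) 2).le
  have hη0 : ∀ k, 0 ≤ t / r k ^ 3 := fun k => div_nonneg ht (pow_pos (hr0 k) 3).le
  -- Without the noise, the momentum error obeys a recursion driven only by the drift of `h`.
  set d : ℕ → ℝ := fun k => ‖m k - h (x k) - M k‖ with hd
  have hdrift : ∀ k, ‖h (x k) - h (x (k + 1))‖ ≤ L₁ * √n * t * (1 / r k ^ 3) := fun k => by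
    rw [norm_sub_rev]
    refine (hlip _ _).trans ?_
    rw [hx k]
    calc _ ≤ L₁ * (√n * (t / r k ^ 3)) :=
          mul_le_mul_of_nonneg_left (norm_signStep_sub_le (hη0 k) _ _) hL₁
      _ = _ := by ring
  have hdrec : ∀ k, d (k + 1) ≤ (1 - s₂ / r k ^ 2) * d k + L₁ * √n * t * (1 / r k ^ 3) := fun k => by
    have e : m (k + 1) - h (x (k + 1)) - M (k + 1) =
        (1 - s₂ / r k ^ 2) • (m k - h (x k) - M k) + (h (x k) - h (x (k + 1))) := by
      rw [hm k, hM k]; module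
    simp only [hd]
    rw [e]
    refine (norm_add_le _ _).trans (add_le_add ?_ (hdrift k))
    rw [norm_smul, Real.norm_eq_abs, abs_of_nonneg (sub_nonneg.2 (hα1 k))]
  have hdsum : ∑ k ∈ Finset.range (K + 1), 1 / r k ^ 3 * d k ≤
      (‖m 0‖ + L + L₁ * √n * t * H) / σ := by
    -- The weight `1 / r k` is the ratio of the orders of the two steps: times `s₂ / r k ^ 2` it
    -- controls the descent weight, and times the drift it gives `1 / r k ^ 4`.
    have h1 := sum_mul_le_of_contraction (d := d) (w := fun k => 1 / r k)
      (s := fun k => s₂ / r k ^ 2) (c := fun k => σ * (1 / r k ^ 3))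
      (fun k => norm_nonneg _)
      (fun i j hij => one_div_le_one_div_of_le (hr0 i) (hrmono hij))
      (fun k => (one_div_pos.2 (hr0 k)).le)
      (fun k => by
        have : 1 / r k * (s₂ / r k ^ 2) = s₂ * (1 / r k ^ 3) := by
          have := (hr0 k).ne'
          field_simp
        rw [this]
        exact mul_le_mul_of_nonneg_right hσs (one_div_pos.2 (pow_pos (hr0 k) 3)).le) hdrec (K + 1)
    have h2 : d 0 ≤ ‖m 0‖ + L := by
      simp only [hd, hM0, sub_zero]
      exact (norm_sub_le _ _).trans (add_le_add_right (hh _) _)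
    have h3 : 1 / r 0 * d 0 ≤ d 0 :=
      mul_le_of_le_one_left (norm_nonneg _) (div_le_one_of_le₀ (hr1 0) (hr0 0).le)
    have h4 : ∑ k ∈ Finset.range (K + 1), 1 / r k * (L₁ * √n * t * (1 / r k ^ 3)) =
        L₁ * √n * t * H := by
      rw [hH, Finset.mul_sum]
      refine Finset.sum_congr rfl fun k _ => ?_
      have := (hr0 k).ne'
      field_simp
    rw [h4] at h1
    rw [le_div_iff₀ hσ, mul_comm, Finset.mul_sum]
    simp only [← mul_assoc] at h1 ⊢
    linarith
  have hstep : ∀ k, t / r k ^ 3 * ‖h (x k)‖ ≤ φ (x k) - φ (x (k + 1)) +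
      (2 * √n * t * (1 / r k ^ 3 * d k + (n / 2 * (1 / r k ^ 4) +
        1 / (2 * n) * (1 / r k ^ 2 * ‖M (k + 1)‖ ^ 2))) + L₁ * n * t ^ 2 * (1 / r k ^ 4)) := fun k => by
    have h1 := hdesc (x k) (x (k + 1))
    have h2 := inner_signStep_sub_le (hη0 k) (h (x k)) (x k) (m (k + 1))
    have h3 := norm_signStep_sub_le (hη0 k) (x k) (m (k + 1))
    rw [← hx k] at h2 h3
    have h4 : L₁ * ‖x (k + 1) - x k‖ ^ 2 ≤ L₁ * n * t ^ 2 * (1 / r k ^ 4) := by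
      calc L₁ * ‖x (k + 1) - x k‖ ^ 2 ≤ L₁ * (√n * (t / r k ^ 3)) ^ 2 := by gcongr
        _ = L₁ * n * t ^ 2 * (1 / r k ^ 6) := by
          rw [mul_pow, Real.sq_sqrt (by positivity)]
          ring
        _ ≤ _ := by
          refine mul_le_mul_of_nonneg_left ?_ (by positivity)
          exact one_div_le_one_div_of_le (pow_pos (hr0 k) 4)
            (pow_le_pow_right₀ (hr1 k) (by norm_num))
    have h5 : ‖m (k + 1) - h (x k)‖ ≤ d k + ‖M (k + 1)‖ := by
      have e : m (k + 1) - h (x k) =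
          (1 - s₂ / r k ^ 2) • (m k - h (x k) - M k) + M (k + 1) := by
        rw [hm k, hM k]; module
      rw [e]
      refine (norm_add_le _ _).trans (add_le_add_left ?_ _)
      rw [norm_smul, Real.norm_eq_abs, abs_of_nonneg (sub_nonneg.2 (hα1 k))]
      exact mul_le_of_le_one_left (norm_nonneg _) (by linarith [hα0 k])
    -- Young's inequality, with weight `n` because `‖M‖²` has mean of order `n²`: both terms then
    -- contribute order `n`.
    have h6 : 1 / r k ^ 3 * ‖M (k + 1)‖ ≤ n / 2 * (1 / r k ^ 4) +
        1 / (2 * n) * (1 / r k ^ 2 * ‖M (k + 1)‖ ^ 2) := by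
      have hrk := hr0 k
      have e : n / 2 * (1 / r k ^ 4) + 1 / (2 * n) * (1 / r k ^ 2 * ‖M (k + 1)‖ ^ 2) -
          1 / r k ^ 3 * ‖M (k + 1)‖ = (n - r k * ‖M (k + 1)‖) ^ 2 / (2 * n * r k ^ 4) := by
        field_simp; ring
      have : 0 ≤ (n - r k * ‖M (k + 1)‖) ^ 2 / (2 * n * r k ^ 4) := by positivity
      linarith
    have h7 : 2 * √n * (t / r k ^ 3) * ‖m (k + 1) - h (x k)‖ ≤
        2 * √n * t * (1 / r k ^ 3 * d k + (n / 2 * (1 / r k ^ 4) +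
        1 / (2 * n) * (1 / r k ^ 2 * ‖M (k + 1)‖ ^ 2))) := by
      calc _ ≤ 2 * √n * (t / r k ^ 3) * (d k + ‖M (k + 1)‖) :=
            mul_le_mul_of_nonneg_left h5 (mul_nonneg (by positivity) (hη0 k))
        _ = 2 * √n * t * (1 / r k ^ 3 * d k + 1 / r k ^ 3 * ‖M (k + 1)‖) := by ring
        _ ≤ _ := mul_le_mul_of_nonneg_left (add_le_add_right h6 _) (by positivity)
    linarith
  have hpos : ∀ k, 0 ≤ 2 * √n * t * (1 / r k ^ 3 * d k + (n / 2 * (1 / r k ^ 4) +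
        1 / (2 * n) * (1 / r k ^ 2 * ‖M (k + 1)‖ ^ 2))) + L₁ * n * t ^ 2 * (1 / r k ^ 4) := fun k => by
    have := hr0 k
    have : 0 ≤ d k := norm_nonneg _
    positivity
  -- The descent starts at `C`, but the error recursions start at 0; the error terms are
  -- nonnegative, so their sum may be extended.
  have hsub : Finset.Icc C K ⊆ Finset.range (K + 1) := fun k hk => by
    simp only [Finset.mem_Icc, Finset.mem_range] at hk ⊢; omega
  calc t / r K ^ 3 * ∑ k ∈ Finset.Icc C K, ‖h (x k)‖
      ≤ ∑ k ∈ Finset.Icc C K, t / r k ^ 3 * ‖h (x k)‖ := by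
        rw [Finset.mul_sum]
        refine Finset.sum_le_sum fun k hk => mul_le_mul_of_nonneg_right ?_ (norm_nonneg _)
        have := hr0 k
        have := hrmono (Finset.mem_Icc.1 hk).2
        gcongr
    _ ≤ ∑ k ∈ Finset.Icc C K, (φ (x k) - φ (x (k + 1))) +
        ∑ k ∈ Finset.Icc C K, (2 * √n * t * (1 / r k ^ 3 * d k + (n / 2 * (1 / r k ^ 4) +
        1 / (2 * n) * (1 / r k ^ 2 * ‖M (k + 1)‖ ^ 2))) + L₁ * n * t ^ 2 * (1 / r k ^ 4)) := by
        rw [← Finset.sum_add_distrib]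
        exact Finset.sum_le_sum fun k _ => hstep k
    _ ≤ D + ∑ k ∈ Finset.range (K + 1), (2 * √n * t * (1 / r k ^ 3 * d k + (n / 2 * (1 / r k ^ 4) +
        1 / (2 * n) * (1 / r k ^ 2 * ‖M (k + 1)‖ ^ 2))) + L₁ * n * t ^ 2 * (1 / r k ^ 4)) := by
        refine add_le_add ?_ (Finset.sum_le_sum_of_subset_of_nonneg hsub fun k _ _ => hpos k)
        have : ∑ k ∈ Finset.Icc C K, (φ (x k) - φ (x (k + 1))) = φ (x C) - φ (x (K + 1)) := by
          rw [← Finset.Ico_add_one_right_eq_Icc]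
          have := Finset.sum_Ico_sub (fun k => φ (x k)) (by omega : C ≤ K + 1)
          rw [← neg_inj, ← Finset.sum_neg_distrib]
          simp only [neg_sub]
          exact this
        rw [this]
        exact hD _
    _ = D + (2 * √n * t * (∑ k ∈ Finset.range (K + 1), 1 / r k ^ 3 * d k + (n / 2 * H +
        1 / (2 * n) * ∑ k ∈ Finset.range (K + 1), 1 / r k ^ 2 * ‖M (k + 1)‖ ^ 2)) +
        L₁ * n * t ^ 2 * H) := by
        simp only [hH, Finset.mul_sum, Finset.sum_add_distrib, mul_add]
    _ ≤ _ := by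
        have := mul_le_mul_of_nonneg_left hdsum (by positivity : 0 ≤ 2 * √n * t)
        linarith

end Deterministic

/-! ### Independence of the state from fresh samples, and the uniform index -/

section Independence

variable {Ω S A : Type*} [MeasurableSpace Ω] [MeasurableSpace S] [MeasurableSpace A]
  {P : Measure Ω}

lemma indepFun_row_future {q : ℕ} {V : ℕ × Fin q → Ω → A} (hV : ∀ p, Measurable (V p))
    (h : iIndepFun V P) (k : ℕ) :
    IndepFun (fun ω j => V (k, j) ω) (fun ω i j => V (k + 1 + i, j) ω) P := by
  have key := indep_iSup_of_disjoint (m := fun p => MeasurableSpace.comap (V p) inferInstance)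
    (fun p => (hV p).comap_le) h (S := {p | p.1 = k}) (T := {p | k + 1 ≤ p.1})
    (Set.disjoint_left.2 fun p hp hp' => by simp at hp hp'; omega)
  have hmeas : ∀ (U : Set (ℕ × Fin q)) (p), p ∈ U →
      Measurable[⨆ p ∈ U, MeasurableSpace.comap (V p) inferInstance] (V p) := fun U p hp =>
    (comap_measurable (V p)).mono
      (le_iSup₂ (f := fun p (_ : p ∈ U) => MeasurableSpace.comap (V p) inferInstance) p hp) le_rfl
  refine indep_of_indep_of_le_left (indep_of_indep_of_le_right key ?_) ?_
  · refine Measurable.comap_le ?_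
    refine (@measurable_pi_iff _ _ _ (_) _ _).2 fun i =>
      (@measurable_pi_iff _ _ _ (_) _ _).2 fun j => hmeas _ _ ?_
    simp only [Set.mem_ofPred_eq]
    omega
  · refine Measurable.comap_le ?_
    exact (@measurable_pi_iff _ _ _ (_) _ _).2 fun j => hmeas _ _ rfl

variable [IsProbabilityMeasure P]

/-- The two hypotheses make the joint law a triple product, which can be reassociated. -/
lemma indepFun_prodMk_of_indepFun {B : Type*} [MeasurableSpace B] {X : Ω → S} {Y : Ω → A}
    {Z : Ω → B} (hX : Measurable X) (hY : Measurable Y) (hZ : Measurable Z)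
    (h : IndepFun X (fun ω => (Y ω, Z ω)) P) (h' : IndepFun Y Z P) :
    IndepFun (fun ω => (X ω, Y ω)) Z P := by
  have hXY : IndepFun X Y P := h.comp measurable_id measurable_fst
  rw [indepFun_iff_map_prod_eq_prod_map_map (by fun_prop) (by fun_prop)] at h h' hXY ⊢
  have := Measure.isProbabilityMeasure_map (μ := P) hX.aemeasurable
  have := Measure.isProbabilityMeasure_map (μ := P) hY.aemeasurable
  have := Measure.isProbabilityMeasure_map (μ := P) hZ.aemeasurable
  rw [h'] at h
  have e := congrArg (Measure.map MeasurableEquiv.prodAssoc.symm) h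
  rw [Measure.map_map (by fun_prop) (by fun_prop)] at e
  rw [hXY]
  refine Eq.trans ?_ (e.trans ?_)
  · rfl
  · rw [← (measurePreserving_prodAssoc (P.map X) (P.map Y) (P.map Z)).map_eq,
      Measure.map_map (by fun_prop) (by fun_prop)]
    simp

/-- The state of a chain driven by independent inputs is independent of the coming input. -/
lemma indepFun_state_input {X : ℕ → Ω → S} {W : ℕ → Ω → A} {T : ℕ → S × A → S}
    (hT : ∀ k, Measurable (T k)) (hX : ∀ k, Measurable (X k)) (hW : ∀ k, Measurable (W k))
    (hrec : ∀ k ω, X (k + 1) ω = T k (X k ω, W k ω))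
    (h0 : IndepFun (X 0) (fun ω k => W k ω) P)
    (hind : ∀ k, IndepFun (W k) (fun ω i => W (k + 1 + i) ω) P) (k : ℕ) :
    IndepFun (X k) (W k) P := by
  -- The induction needs independence from all inputs from time `k` on.
  suffices IndepFun (X k) (fun ω i => W (k + i) ω) P from
    this.comp measurable_id (measurable_pi_apply 0)
  induction k with
  | zero => simpa using h0
  | succ k ih =>
    have h1 : IndepFun (X k) (fun ω => (W k ω, fun i => W (k + 1 + i) ω)) P := by
      have := ih.comp (φ := id) (ψ := fun w : ℕ → A => (w 0, fun i => w (1 + i))) measurable_id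
        (by fun_prop)
      simpa [Function.comp_def, add_assoc] using this
    have h2 := indepFun_prodMk_of_indepFun (hX k) (hW k) (by fun_prop) h1 (hind k)
    rw [funext (hrec k)]
    exact h2.comp (hT k) measurable_id

/-- Under the product law, Fubini freezes the state; this replaces conditioning on the past. -/
lemma integral_eq_zero_of_indepFun {X : Ω → S} {W : Ω → A} {Ψ : S × A → ℝ} (hX : Measurable X)
    (hW : Measurable W) (hΨ : Measurable Ψ) (h : IndepFun X W P)
    (hInt : Integrable (fun ω => Ψ (X ω, W ω)) P) (h0 : ∀ s, ∫ ω, Ψ (s, W ω) ∂P = 0) :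
    ∫ ω, Ψ (X ω, W ω) ∂P = 0 := by
  have hXW : Measurable fun ω => (X ω, W ω) := hX.prodMk hW
  have := Measure.isProbabilityMeasure_map (μ := P) hX.aemeasurable
  have := Measure.isProbabilityMeasure_map (μ := P) hW.aemeasurable
  have hlaw := (indepFun_iff_map_prod_eq_prod_map_map hX.aemeasurable hW.aemeasurable).1 h
  have hInt' : Integrable Ψ ((P.map X).prod (P.map W)) := by
    rw [← hlaw, integrable_map_measure hΨ.aestronglyMeasurable hXW.aemeasurable]
    exact hInt
  rw [← integral_map (φ := fun ω => (X ω, W ω)) hXW.aemeasurable hΨ.aestronglyMeasurable, hlaw,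
    integral_prod _ hInt']
  refine (integral_congr_ae (.of_forall fun s => ?_)).trans (integral_zero _ _)
  rw [integral_map (f := fun y => Ψ (s, y)) hW.aemeasurable 
    (hΨ.comp measurable_prodMk_left).aestronglyMeasurable, h0]

/-- Averaging over an independent uniform index. -/
lemma integral_comp_uniformIndex {C K : ℕ} (hCK : C ≤ K) {R : Ω → ℕ} (hR : Measurable R)
    (hlaw : HasLaw R (uniformOn (Set.Icc C K)) P) {Z : Ω → S} {Φ : ℕ → S → ℝ}
    (hZ : Measurable Z) (hΦ : ∀ k, Measurable (Φ k)) {c : ℝ} (hc : ∀ k s, |Φ k s| ≤ c)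
    (hind : IndepFun R Z P) :
    Integrable (fun ω => Φ (R ω) (Z ω)) P ∧
    ∫ ω, Φ (R ω) (Z ω) ∂P =
      ((K : ℝ) + 1 - C)⁻¹ * ∑ k ∈ Finset.Icc C K, ∫ ω, Φ k (Z ω) ∂P := by
  have hm : Measurable fun p : ℕ × S => Φ p.1 p.2 :=
    measurable_from_prod_countable_right hΦ
  have hInt : ∀ (μ : Measure (ℕ × S)) [IsFiniteMeasure μ], Integrable (fun p => Φ p.1 p.2) μ :=
    fun μ _ => (integrable_const c).mono' hm.aestronglyMeasurable (.of_forall fun p => hc _ _)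
  have hRZ : Measurable fun ω => (R ω, Z ω) := hR.prodMk hZ
  have := Measure.isProbabilityMeasure_map (μ := P) hR.aemeasurable
  have := Measure.isProbabilityMeasure_map (μ := P) hZ.aemeasurable
  refine ⟨(integrable_const c).mono' (hm.comp hRZ).aestronglyMeasurable
    (.of_forall fun p => hc _ _), ?_⟩
  have hjoint := (indepFun_iff_map_prod_eq_prod_map_map hR.aemeasurable hZ.aemeasurable).1 hind
  have hcard : Measure.count (Set.Icc C K) = ((K + 1 - C : ℕ) : ENNReal) := by
    rw [← Finset.coe_Icc, Measure.count_apply_finset, Nat.card_Icc]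
  rw [← integral_map (φ := fun ω => (R ω, Z ω)) (f := fun p => Φ p.1 p.2) hRZ.aemeasurable
    hm.aestronglyMeasurable, hjoint, integral_prod _ (hInt _), hlaw.map_eq, uniformOn,
    ProbabilityTheory.cond,
    integral_smul_measure, hcard, ← Finset.coe_Icc, setIntegral_finset _ (by
      rw [IntegrableOn, Finset.coe_Icc]
      have : IsFiniteMeasure (Measure.count.restrict (Set.Icc C K) : Measure ℕ) :=
        ⟨by rw [Measure.restrict_apply_univ, hcard]; exact ENNReal.natCast_lt_top _⟩
      refine (integrable_const c).mono' (measurable_from_top).aestronglyMeasurable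
        (.of_forall fun k => ?_)
      refine (norm_integral_le_of_norm_le_const (C := c) (.of_forall fun s => hc k s)).trans ?_
      simp)]
  rw [smul_eq_mul, ENNReal.toReal_inv, ENNReal.toReal_natCast, Nat.cast_sub (by omega)]
  push_cast
  congr 1
  refine Finset.sum_congr rfl fun k _ => ?_
  rw [integral_map hZ.aemeasurable (hΦ k).aestronglyMeasurable]
  simp

end Independence

/-! ### Accumulated noise and the size of a batch error -/

section Noise

/-- The exponentially averaged error of the gradient estimates with respect to `h`, accumulated by
the momentum of the ZO-Signum recursion. -/
def momentumNoise {Ξ : Type*} (F : EuclideanSpace ℝ (Fin n) → Ξ → ℝ) (β : ℝ) (s₁ s₂ : ℕ → ℝ)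
    (h : EuclideanSpace ℝ (Fin n) → EuclideanSpace ℝ (Fin n))
    (x₀ m₀ : EuclideanSpace ℝ (Fin n)) (u : ℕ → Fin q → EuclideanSpace ℝ (Fin n))
    (ξ : ℕ → Fin q → Ξ) : ℕ → EuclideanSpace ℝ (Fin n)
  | 0 => 0
  | k + 1 => (1 - s₂ k) • momentumNoise F β s₁ s₂ h x₀ m₀ u ξ k +
      s₂ k • (gradEstimate F β (iterate F β s₁ s₂ x₀ m₀ u ξ k).1 (u k) (ξ k) -
        h (iterate F β s₁ s₂ x₀ m₀ u ξ k).1)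

/-- The Lipschitz bound cancels the division by `β`, making the estimate uniform in the point.
Cauchy–Schwarz over the batch keeps it free of `q`, without any variance reduction. -/
lemma sq_norm_gradEstimate_sub_le {Ξ : Type*} {L : ℝ≥0} {F : EuclideanSpace ℝ (Fin n) → Ξ → ℝ}
    {β : ℝ} (hL : ∀ ξ, LipschitzWith L fun x => F x ξ) (hβ : 0 < β) (hq : 1 ≤ q)
    (x y : EuclideanSpace ℝ (Fin n)) (hy : ‖y‖ ≤ L) (u : Fin q → EuclideanSpace ℝ (Fin n))
    (ξ : Fin q → Ξ) :
    ‖gradEstimate F β x u ξ - y‖ ^ 2 ≤ 2 * L ^ 2 * ((1 / (q : ℝ)) * ∑ j, (‖u j‖ ^ 4 + 1)) := by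
  have hq0 : (0 : ℝ) < q := by exact_mod_cast hq
  have h1 : ‖gradEstimate F β x u ξ‖ ≤ (1 / (q : ℝ)) * ∑ j, L * ‖u j‖ ^ 2 := by
    rw [gradEstimate, norm_smul, Real.norm_eq_abs, abs_of_pos (by positivity)]
    refine mul_le_mul_of_nonneg_left ?_ (by positivity)
    exact (norm_sum_le _ _).trans
      (Finset.sum_le_sum fun j _ => norm_finiteDifference_smul_le hL hβ x (u j) (ξ j))
  have h2 : ‖gradEstimate F β x u ξ - y‖ ≤ (1 / (q : ℝ)) * ∑ j, L * (‖u j‖ ^ 2 + 1) := by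
    refine (norm_sub_le _ _).trans ((add_le_add h1 hy).trans_eq ?_)
    simp only [mul_add, Finset.sum_add_distrib]
    simp
    field_simp
  have h3 := sq_sum_le_card_mul_sum_sq (s := Finset.univ) (f := fun j => L * (‖u j‖ ^ 2 + 1))
  rw [Finset.card_univ, Fintype.card_fin] at h3
  calc ‖gradEstimate F β x u ξ - y‖ ^ 2
      ≤ ((1 / (q : ℝ)) * ∑ j, L * (‖u j‖ ^ 2 + 1)) ^ 2 := pow_le_pow_left₀ (norm_nonneg _) h2 2
    _ = (1 / (q : ℝ)) ^ 2 * (∑ j, L * (‖u j‖ ^ 2 + 1)) ^ 2 := mul_pow _ _ _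
    _ ≤ (1 / (q : ℝ)) ^ 2 * (q * ∑ j, (L * (‖u j‖ ^ 2 + 1)) ^ 2) :=
        mul_le_mul_of_nonneg_left h3 (by positivity)
    _ = (1 / (q : ℝ)) * ∑ j, (L * (‖u j‖ ^ 2 + 1)) ^ 2 := by field_simp
    _ ≤ (1 / (q : ℝ)) * ∑ j, 2 * L ^ 2 * (‖u j‖ ^ 4 + 1) := by
        refine mul_le_mul_of_nonneg_left (Finset.sum_le_sum fun j _ => ?_) (by positivity)
        rw [mul_pow]
        nlinarith [mul_nonneg (sq_nonneg (L : ℝ)) (sq_nonneg (‖u j‖ ^ 2 - 1))]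
    _ = _ := by rw [← Finset.mul_sum]; ring

/-- The transition map of the ZO-Signum recursion augmented by the noise: from the state
`((x, m), M)` and the samples of one iteration to the next state. -/
def augmentedStep {Ξ : Type*} (F : EuclideanSpace ℝ (Fin n) → Ξ → ℝ) (β a b : ℝ)
    (h : EuclideanSpace ℝ (Fin n) → EuclideanSpace ℝ (Fin n))
    (p : ((EuclideanSpace ℝ (Fin n) × EuclideanSpace ℝ (Fin n)) × EuclideanSpace ℝ (Fin n)) ×
      (Fin q → EuclideanSpace ℝ (Fin n) × Ξ)) :
    (EuclideanSpace ℝ (Fin n) × EuclideanSpace ℝ (Fin n)) × EuclideanSpace ℝ (Fin n) :=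
  let g := gradEstimate F β p.1.1.1 (fun j => (p.2 j).1) (fun j => (p.2 j).2)
  let m' := b • g + (1 - b) • p.1.1.2
  ((signStep a p.1.1.1 m', m'), (1 - b) • p.1.2 + b • (g - h p.1.1.1))

variable {Ξ : Type*} [MeasurableSpace Ξ] {ν : Measure Ξ} [IsProbabilityMeasure ν] {L : ℝ≥0}
  {F : EuclideanSpace ℝ (Fin n) → Ξ → ℝ} {β : ℝ}

lemma measurable_gradEstimate {α : Type*} [MeasurableSpace α] (hm : ∀ x, Measurable (F x))
    (hL : ∀ ξ, LipschitzWith L fun x => F x ξ) (β : ℝ) {x : α → EuclideanSpace ℝ (Fin n)}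
    {w : α → Fin q → EuclideanSpace ℝ (Fin n) × Ξ} (hx : Measurable x) (hw : Measurable w) :
    Measurable fun a => gradEstimate F β (x a) (fun j => (w a j).1) (fun j => (w a j).2) := by
  have h : ∀ j, Measurable fun a =>
      ((F (x a + β • (w a j).1) (w a j).2 - F (x a) (w a j).2) / β) • (w a j).1 := fun j => by
    have hp : Measurable fun a => (x a, w a j) := hx.prodMk (by fun_prop)
    have := (measurable_finiteDifference_smul hm hL β).comp hp
    simpa only [Function.comp_def] using this
  exact (Finset.measurable_fun_sum Finset.univ fun j _ => h j).const_smul (1 / (q : ℝ))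

lemma _root_.Real.measurable_sign : Measurable Real.sign := by
  unfold Real.sign
  exact Measurable.ite measurableSet_Iio measurable_const
    (Measurable.ite measurableSet_Ioi measurable_const measurable_const)

lemma measurable_signStep {α : Type*} [MeasurableSpace α] (s : ℝ)
    {x m : α → EuclideanSpace ℝ (Fin n)} (hx : Measurable x) (hm : Measurable m) :
    Measurable fun a => signStep s (x a) (m a) := by
  have := Real.measurable_sign
  unfold signStep
  fun_prop

lemma measurable_augmentedStep (hm : ∀ x, Measurable (F x))
    (hL : ∀ ξ, LipschitzWith L fun x => F x ξ) (β a b : ℝ)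
    {h : EuclideanSpace ℝ (Fin n) → EuclideanSpace ℝ (Fin n)} (hh : Measurable h) :
    Measurable (augmentedStep (q := q) F β a b h) := by
  have hg := measurable_gradEstimate (q := q) hm hL β
    (α := ((EuclideanSpace ℝ (Fin n) × EuclideanSpace ℝ (Fin n)) × EuclideanSpace ℝ (Fin n)) ×
      (Fin q → EuclideanSpace ℝ (Fin n) × Ξ)) (x := fun p => p.1.1.1) (w := fun p => p.2)
    (by fun_prop) (by fun_prop)
  have hs := measurable_signStep a
    (α := ((EuclideanSpace ℝ (Fin n) × EuclideanSpace ℝ (Fin n)) × EuclideanSpace ℝ (Fin n)) ×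
      (Fin q → EuclideanSpace ℝ (Fin n) × Ξ)) (x := fun p => p.1.1.1)
    (m := fun p => b • gradEstimate F β p.1.1.1 (fun j => (p.2 j).1) (fun j => (p.2 j).2) +
      (1 - b) • p.1.1.2)
    (by fun_prop) (by fun_prop)
  have hM : Measurable fun
      p : ((EuclideanSpace ℝ (Fin n) × EuclideanSpace ℝ (Fin n)) × EuclideanSpace ℝ (Fin n)) ×
        (Fin q → EuclideanSpace ℝ (Fin n) × Ξ) => (1 - b) • p.1.2 +
        b • (gradEstimate F β p.1.1.1 (fun j => (p.2 j).1) (fun j => (p.2 j).2) - h p.1.1.1) := by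
    fun_prop
  exact (hs.prodMk (by fun_prop)).prodMk hM

variable {Ω : Type*} [MeasurableSpace Ω] {P : Measure Ω}

lemma integral_gradEstimate (hm : ∀ x, Measurable (F x)) (hi : ∀ x, Integrable (F x) ν)
    (hL : ∀ ξ, LipschitzWith L fun x => F x ξ) (hβ : 0 < β) (hq : 1 ≤ q)
    {u : Fin q → Ω → EuclideanSpace ℝ (Fin n)} {ξ : Fin q → Ω → Ξ}
    (hlaw : ∀ j, HasLaw (fun ω => (u j ω, ξ j ω))
      ((stdGaussian (EuclideanSpace ℝ (Fin n))).prod ν) P) (x : EuclideanSpace ℝ (Fin n)) :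
    Integrable (fun ω => gradEstimate F β x (fun j => u j ω) (fun j => ξ j ω)) P ∧
    ∫ ω, gradEstimate F β x (fun j => u j ω) (fun j => ξ j ω) ∂P =
      ∇ (smoothing (objective ν F) β) x := by
  have hq0 : (q : ℝ) ≠ 0 := by positivity
  have hInt0 := integrable_finiteDifference_smul (ν := ν) hm hL hβ x
  have hInt : ∀ j, Integrable
      (fun ω => ((F (x + β • u j ω) (ξ j ω) - F x (ξ j ω)) / β) • u j ω) P := fun j => by
    have := hInt0
    rw [← (hlaw j).map_eq] at this
    exact this.comp_aemeasurable (hlaw j).aemeasurable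
  have heq : ∀ j, ∫ ω, ((F (x + β • u j ω) (ξ j ω) - F x (ξ j ω)) / β) • u j ω ∂P =
      ∇ (smoothing (objective ν F) β) x := fun j => by
    rw [← integral_finiteDifference_smul hm hi hL hβ x]
    exact (hlaw j).integral_comp hInt0.aestronglyMeasurable
  unfold gradEstimate
  refine ⟨(integrable_finsetSum _ fun j _ => hInt j).fun_smul _, ?_⟩
  rw [integral_smul, integral_finsetSum _ fun j _ => hInt j]
  simp only [heq, Finset.sum_const, Finset.card_univ, Fintype.card_fin]
  rw [← Nat.cast_smul_eq_nsmul ℝ, smul_smul, one_div, inv_mul_cancel₀ hq0, one_smul]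

lemma integral_batch_norm_pow_four_le [IsProbabilityMeasure P] (hn : 1 ≤ n) (hq : 1 ≤ q)
    {u : Fin q → Ω → EuclideanSpace ℝ (Fin n)} {ξ : Fin q → Ω → Ξ}
    (hlaw : ∀ j, HasLaw (fun ω => (u j ω, ξ j ω))
      ((stdGaussian (EuclideanSpace ℝ (Fin n))).prod ν) P) :
    Integrable (fun ω => (1 / (q : ℝ)) * ∑ j, (‖u j ω‖ ^ 4 + 1)) P ∧
    ∫ ω, (1 / (q : ℝ)) * ∑ j, (‖u j ω‖ ^ 4 + 1) ∂P ≤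
      ((∫ x, x ^ 4 ∂(gaussianReal 0 1)) + 1) * n ^ 2 := by
  have hn' : (1 : ℝ) ≤ n := by exact_mod_cast hn
  have hq0 : (q : ℝ) ≠ 0 := by positivity
  have hu : ∀ j, HasLaw (u j) (stdGaussian (EuclideanSpace ℝ (Fin n))) P := fun j => by
    have h1 : HasLaw (Prod.fst : EuclideanSpace ℝ (Fin n) × Ξ → EuclideanSpace ℝ (Fin n))
        (stdGaussian (EuclideanSpace ℝ (Fin n)))
        ((stdGaussian (EuclideanSpace ℝ (Fin n))).prod ν) :=
      measurePreserving_fst.hasLaw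
    exact h1.comp (hlaw j)
  have hInt : ∀ j, Integrable (fun ω => ‖u j ω‖ ^ 4) P := fun j => by
    have := integrable_norm_pow_stdGaussian (n := n) 4
    rw [← (hu j).map_eq] at this
    exact this.comp_aemeasurable (hu j).aemeasurable
  have hle : ∀ j, ∫ ω, ‖u j ω‖ ^ 4 ∂P ≤ (∫ x, x ^ 4 ∂(gaussianReal 0 1)) * n ^ 2 := fun j => by
    refine Eq.trans_le ?_ integral_norm_pow_four_stdGaussian_le
    exact (hu j).integral_comp (f := fun v => ‖v‖ ^ 4)
      (integrable_norm_pow_stdGaussian (n := n) 4).aestronglyMeasurable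
  have hInt' : ∀ j, Integrable (fun ω => ‖u j ω‖ ^ 4 + 1) P :=
    fun j => (hInt j).add (integrable_const 1)
  refine ⟨(integrable_finsetSum _ fun j _ => hInt' j).const_mul _, ?_⟩
  rw [integral_const_mul, integral_finsetSum _ fun j _ => hInt' j]
  calc _ ≤ (1 / (q : ℝ)) * ∑ _j : Fin q, ((∫ x, x ^ 4 ∂(gaussianReal 0 1)) + 1) * (n : ℝ) ^ 2 := by
        refine mul_le_mul_of_nonneg_left (Finset.sum_le_sum fun j _ => ?_) (by positivity)
        rw [integral_add (hInt j) (integrable_const 1)]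
        simp only [integral_const, probReal_univ, smul_eq_mul, mul_one]
        nlinarith [hle j]
    _ = _ := by
        simp only [Finset.sum_const, Finset.card_univ, Fintype.card_fin, nsmul_eq_mul]
        field_simp

end Noise

/-! ### Second moment of the accumulated noise -/

section SecondMoment

/-- The state `((x^k, m^k), M^k)` of the ZO-Signum recursion augmented by the noise. -/
def augmentedIterate {Ξ : Type*} (F : EuclideanSpace ℝ (Fin n) → Ξ → ℝ) (β : ℝ) (s₁ s₂ : ℕ → ℝ)
    (h : EuclideanSpace ℝ (Fin n) → EuclideanSpace ℝ (Fin n))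
    (x₀ m₀ : EuclideanSpace ℝ (Fin n)) (w : ℕ → Fin q → EuclideanSpace ℝ (Fin n) × Ξ) (k : ℕ) :
    (EuclideanSpace ℝ (Fin n) × EuclideanSpace ℝ (Fin n)) × EuclideanSpace ℝ (Fin n) :=
  (iterate F β s₁ s₂ x₀ m₀ (fun k j => (w k j).1) (fun k j => (w k j).2) k,
    momentumNoise F β s₁ s₂ h x₀ m₀ (fun k j => (w k j).1) (fun k j => (w k j).2) k)

lemma augmentedIterate_succ {Ξ : Type*} (F : EuclideanSpace ℝ (Fin n) → Ξ → ℝ) (β : ℝ) (s₁ s₂ : ℕ → ℝ)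
    (h : EuclideanSpace ℝ (Fin n) → EuclideanSpace ℝ (Fin n))
    (x₀ m₀ : EuclideanSpace ℝ (Fin n)) (w : ℕ → Fin q → EuclideanSpace ℝ (Fin n) × Ξ) (k : ℕ) :
    augmentedIterate F β s₁ s₂ h x₀ m₀ w (k + 1) =
      augmentedStep F β (s₁ k) (s₂ k) h (augmentedIterate F β s₁ s₂ h x₀ m₀ w k, w k) :=
  rfl

variable {Ξ : Type*} [MeasurableSpace Ξ] {ν : Measure Ξ} [IsProbabilityMeasure ν] {L : ℝ≥0}
  {F : EuclideanSpace ℝ (Fin n) → Ξ → ℝ} {β : ℝ}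

lemma measurable_augmentedIterate {α : Type*} [MeasurableSpace α] (hm : ∀ x, Measurable (F x))
    (hL : ∀ ξ, LipschitzWith L fun x => F x ξ) (β : ℝ) (s₁ s₂ : ℕ → ℝ)
    {h : EuclideanSpace ℝ (Fin n) → EuclideanSpace ℝ (Fin n)} (hh : Measurable h)
    {x₀ m₀ : α → EuclideanSpace ℝ (Fin n)} {w : α → ℕ → Fin q → EuclideanSpace ℝ (Fin n) × Ξ}
    (hx₀ : Measurable x₀) (hm₀ : Measurable m₀) (hw : Measurable w) (k : ℕ) :
    Measurable fun a => augmentedIterate F β s₁ s₂ h (x₀ a) (m₀ a) (w a) k := by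
  induction k with
  | zero => exact (hx₀.prodMk hm₀).prodMk measurable_const
  | succ k ih =>
    simp only [augmentedIterate_succ]
    exact (measurable_augmentedStep hm hL β (s₁ k) (s₂ k) hh).comp
      (ih.prodMk ((measurable_pi_apply k).comp hw))

variable {Ω : Type*} [MeasurableSpace Ω] {P : Measure Ω} [IsProbabilityMeasure P]

/-- The second moment of the accumulated noise contracts up to the variance of one batch. -/
lemma integral_sq_norm_momentumNoise_succ_le (hn : 1 ≤ n) (hq : 1 ≤ q)
    (hm : ∀ x, Measurable (F x)) (hi : ∀ x, Integrable (F x) ν)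
    (hL : ∀ ξ, LipschitzWith L fun x => F x ξ) (hβ : 0 < β) {s₁ s₂ : ℕ → ℝ}
    (hs0 : ∀ k, 0 ≤ s₂ k) (hs1 : ∀ k, s₂ k ≤ 1)
    {x₀ m₀ : Ω → EuclideanSpace ℝ (Fin n)} {u : ℕ → Fin q → Ω → EuclideanSpace ℝ (Fin n)}
    {ξ : ℕ → Fin q → Ω → Ξ}
    (hx₀ : Measurable x₀) (hm₀ : Measurable m₀) (hu : ∀ k j, Measurable (u k j))
    (hξ : ∀ k j, Measurable (ξ k j))
    (hlaw : ∀ k j, HasLaw (fun ω => (u k j ω, ξ k j ω))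
      ((stdGaussian (EuclideanSpace ℝ (Fin n))).prod ν) P)
    (hiid : iIndepFun (fun (p : ℕ × Fin q) ω => (u p.1 p.2 ω, ξ p.1 p.2 ω)) P)
    (hind : IndepFun (fun ω => (x₀ ω, m₀ ω))
      (fun ω (p : ℕ × Fin q) => (u p.1 p.2 ω, ξ p.1 p.2 ω)) P)
    {M : ℕ → Ω → EuclideanSpace ℝ (Fin n)}
    (hM : M = fun k ω => momentumNoise F β s₁ s₂ (∇ (smoothing (objective ν F) β)) (x₀ ω) (m₀ ω)
      (fun k j => u k j ω) (fun k j => ξ k j ω) k) (k : ℕ) :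
    MemLp (M k) 2 P ∧ ∫ ω, ‖M (k + 1) ω‖ ^ 2 ∂P ≤ (1 - s₂ k) * ∫ ω, ‖M k ω‖ ^ 2 ∂P +
      s₂ k ^ 2 * (2 * L ^ 2 * (((∫ x, x ^ 4 ∂(gaussianReal 0 1)) + 1) * n ^ 2)) := by
  set h := ∇ (smoothing (objective ν F) β) with hh
  have hhm : Measurable h :=
    (continuous_gradient_smoothing hn (lipschitzWith_objective hi hL) hβ).measurable
  have hhL : ∀ y, ‖h y‖ ≤ L := norm_gradient_smoothing_le (lipschitzWith_objective hi hL) β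
  set W : ℕ → Ω → Fin q → EuclideanSpace ℝ (Fin n) × Ξ := fun k ω j => (u k j ω, ξ k j ω) with hW
  have hWm : ∀ k, Measurable (W k) := fun k => by fun_prop
  -- With the noise added to the state, one independence statement covers both `x^k` and `M^k`.
  set X := fun k ω => augmentedIterate F β s₁ s₂ h (x₀ ω) (m₀ ω) (fun k => W k ω) k with hX
  have hXm : ∀ k, Measurable (X k) := fun k =>
    measurable_augmentedIterate hm hL β s₁ s₂ hhm hx₀ hm₀ (by fun_prop) k
  have hXM : ∀ k ω, M k ω = (X k ω).2 := fun k ω => by rw [hM]; rfl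
  have hMm : ∀ k, Measurable (M k) := fun k => by
    rw [funext (hXM k)]; exact measurable_snd.comp (hXm k)
  have hXW : ∀ k, IndepFun (X k) (W k) P := by
    refine indepFun_state_input (T := fun k => augmentedStep F β (s₁ k) (s₂ k) h)
      (fun k => measurable_augmentedStep hm hL β _ _ hhm) hXm hWm (fun k ω => rfl) ?_
      (indepFun_row_future (V := fun (p : ℕ × Fin q) ω => (u p.1 p.2 ω, ξ p.1 p.2 ω))
        (fun p => by fun_prop) hiid)
    exact hind.comp (φ := fun p => (p, (0 : EuclideanSpace ℝ (Fin n))))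
      (ψ := fun (w : ℕ × Fin q → EuclideanSpace ℝ (Fin n) × Ξ) k j => w (k, j))
      (by fun_prop) (by fun_prop)
  set e : ℕ → Ω → EuclideanSpace ℝ (Fin n) := fun k ω =>
    gradEstimate F β (X k ω).1.1 (fun j => u k j ω) (fun j => ξ k j ω) - h (X k ω).1.1 with he
  have hMsucc : ∀ k ω, M (k + 1) ω = (1 - s₂ k) • M k ω + s₂ k • e k ω := fun k ω => by
    rw [hM]; rfl
  have hxm : ∀ k, Measurable fun ω => (X k ω).1.1 := fun k =>
    measurable_fst.comp (measurable_fst.comp (hXm k))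
  have hem : ∀ k, Measurable (e k) := fun k =>
    (measurable_gradEstimate hm hL β (hxm k) (hWm k)).sub (hhm.comp (hxm k))
  have hbatch := fun k => integral_batch_norm_pow_four_le hn hq (hlaw k)
  have hesq : ∀ k ω, ‖e k ω‖ ^ 2 ≤ 2 * L ^ 2 * ((1 / (q : ℝ)) * ∑ j, (‖u k j ω‖ ^ 4 + 1)) :=
    fun k ω => sq_norm_gradEstimate_sub_le hL hβ hq _ _ (hhL _) _ _
  have heInt : ∀ k, Integrable (fun ω => ‖e k ω‖ ^ 2) P := fun k =>
    ((hbatch k).1.const_mul (2 * (L : ℝ) ^ 2)).mono' ((hem k).norm.pow_const 2).aestronglyMeasurable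
      (.of_forall fun ω => by
        rw [Real.norm_eq_abs, abs_of_nonneg (sq_nonneg _)]
        exact hesq k ω)
  have heLp : ∀ k, MemLp (e k) 2 P := fun k =>
    (memLp_two_iff_integrable_sq_norm (hem k).aestronglyMeasurable).2 (heInt k)
  have hev : ∀ k, ∫ ω, ‖e k ω‖ ^ 2 ∂P ≤
      2 * L ^ 2 * (((∫ x, x ^ 4 ∂(gaussianReal 0 1)) + 1) * n ^ 2) := fun k => by
    refine (integral_mono (heInt k) ((hbatch k).1.const_mul (2 * (L : ℝ) ^ 2)) (hesq k)).trans ?_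
    rw [integral_const_mul]
    exact mul_le_mul_of_nonneg_left (hbatch k).2 (by positivity)
  have hMLp : ∀ k, MemLp (M k) 2 P := fun k => by
    induction k with
    | zero =>
      have : M 0 = 0 := by rw [hM]; rfl
      rw [this]; exact MemLp.zero
    | succ k ih =>
      rw [funext (hMsucc k)]
      exact (ih.const_smul (1 - s₂ k)).add ((heLp k).const_smul (s₂ k))
  refine ⟨hMLp k, ?_⟩
  have hMInt : Integrable (fun ω => ‖M k ω‖ ^ 2) P := (hMLp k).integrable_norm_pow (by norm_num)
  have hcrossInt : Integrable (fun ω => ⟪M k ω, e k ω⟫) P := by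
    refine (hMInt.add (heInt k)).mono' ((hMm k).inner (hem k)).aestronglyMeasurable
      (.of_forall fun ω => ?_)
    refine (norm_inner_le_norm _ _).trans ?_
    simp only [Pi.add_apply]
    nlinarith [sq_nonneg (‖M k ω‖ - ‖e k ω‖), sq_nonneg ‖M k ω‖, sq_nonneg ‖e k ω‖]
  -- With the state frozen, the batch error has mean zero by unbiasedness.
  have hcross : ∫ ω, ⟪M k ω, e k ω⟫ ∂P = 0 := by
    simp only [hXM k] at hcrossInt ⊢
    refine integral_eq_zero_of_indepFun (X := X k) (W := W k)
      (Ψ := fun p => ⟪p.1.2, gradEstimate F β p.1.1.1 (fun j => (p.2 j).1) (fun j => (p.2 j).2) -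
        h p.1.1.1⟫) (hXm k) (hWm k) ?_ (hXW k) hcrossInt fun s => ?_
    · have hg := measurable_gradEstimate (q := q) hm hL β
        (α := ((EuclideanSpace ℝ (Fin n) × EuclideanSpace ℝ (Fin n)) × EuclideanSpace ℝ (Fin n)) ×
          (Fin q → EuclideanSpace ℝ (Fin n) × Ξ)) (x := fun p => p.1.1.1) (w := fun p => p.2)
        (by fun_prop) (by fun_prop)
      exact Measurable.inner (by fun_prop) (by fun_prop)
    · obtain ⟨h1, h2⟩ := integral_gradEstimate hm hi hL hβ hq (hlaw k) s.1.1
      have h3 : Integrable (fun ω => gradEstimate F β s.1.1 (fun j => u k j ω) (fun j => ξ k j ω) -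
        h s.1.1) P := h1.sub (integrable_const _)
      simp only [hW]
      rw [integral_inner h3, integral_sub h1 (integrable_const _), h2]
      simp [hh]
  have hexp : ∀ ω, ‖M (k + 1) ω‖ ^ 2 = (1 - s₂ k) ^ 2 * ‖M k ω‖ ^ 2 +
      2 * (1 - s₂ k) * s₂ k * ⟪M k ω, e k ω⟫ + s₂ k ^ 2 * ‖e k ω‖ ^ 2 := fun ω => by
    rw [hMsucc, norm_add_sq_real, norm_smul, norm_smul, mul_pow, mul_pow, inner_smul_left,
      inner_smul_right]
    simp only [Real.norm_eq_abs, sq_abs, conj_trivial]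
    ring
  simp only [hexp]
  rw [integral_add ((hMInt.const_mul _).fun_add (hcrossInt.const_mul _)) ((heInt k).const_mul _),
    integral_add (hMInt.const_mul _) (hcrossInt.const_mul _), integral_const_mul,
    integral_const_mul, integral_const_mul, hcross, mul_zero, add_zero]
  have hM0 : 0 ≤ ∫ ω, ‖M k ω‖ ^ 2 ∂P := integral_nonneg fun ω => sq_nonneg _
  refine add_le_add (mul_le_mul_of_nonneg_right ?_ hM0)
    (mul_le_mul_of_nonneg_left (hev k) (sq_nonneg _))
  -- `(1 - s)² ≤ 1 - s` for `s` in `[0, 1]`.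
  nlinarith [hs0 k, hs1 k]

end SecondMoment

/-! ### From the weighted bound to the rate -/

section Rate

/-- All exponents in play are multiples of `1/4`; fourth roots turn them into natural powers. -/
lemma rpow_div_four {p : ℝ} (hp : 0 ≤ p) (i : ℕ) : p ^ ((i : ℝ) / 4) = (p ^ (1 / 4 : ℝ)) ^ i := by
  rw [← Real.rpow_natCast, ← Real.rpow_mul hp]
  congr 1
  ring

lemma stepSize_three_quarters (s : ℝ) (k : ℕ) :
    stepSize s (3 / 4) k = s / (((k : ℝ) + 1) ^ (1 / 4 : ℝ)) ^ 3 := by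
  rw [stepSize, ← rpow_div_four (by positivity)]
  norm_num

lemma stepSize_half (s : ℝ) (k : ℕ) :
    stepSize s (1 / 2) k = s / (((k : ℝ) + 1) ^ (1 / 4 : ℝ)) ^ 2 := by
  rw [stepSize, ← rpow_div_four (by positivity)]
  norm_num

lemma sum_one_div_le_log {K : ℕ} (hK : 2 ≤ K) :
    ∑ k ∈ Finset.range (K + 1), 1 / ((k : ℝ) + 1) ≤ 4 * Real.log K := by
  have hK' : (2 : ℝ) ≤ K := by exact_mod_cast hK
  have h1 := harmonic_le_one_add_log (K + 1)
  have e : ((harmonic (K + 1) : ℚ) : ℝ) = ∑ k ∈ Finset.range (K + 1), 1 / ((k : ℝ) + 1) := by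
    simp [harmonic]
  rw [e] at h1
  have h2 : Real.log ((K + 1 : ℕ) : ℝ) ≤ 2 * Real.log K := by
    rw [← Real.log_rpow (by linarith), Real.rpow_two]
    refine Real.log_le_log (by positivity) ?_
    push_cast
    nlinarith
  have h3 : 1 ≤ 2 * Real.log K := by
    have := Real.log_le_log (by norm_num) hK'
    linarith [Real.log_two_gt_d9]
  linarith

/-- Bookkeeping with `ρ = n^{1/4}`: after multiplication by `ρ³ r³`, each term is at most a constant
times `ρ⁶ H r³`. The power `ρ⁶ = n^{3/2}` comes from the initial momentum and from the noise. -/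
lemma sum_le_of_scaled_bound {ρ H r S D B L L₁ b σ V m Q : ℝ} (hρ : 1 ≤ ρ) (hH : 1 ≤ H)
    (hr : 0 < r) (hL : 0 ≤ L) (hb : 0 < b) (hσ : 0 < σ)
    (hm : m ≤ B * ρ ^ 4) (hL₁ : L₁ ≤ L / b * ρ ^ 4) (hQ : Q ≤ 2 * V * ρ ^ 8 / σ * H)
    (h : 1 / ρ ^ 3 / r ^ 3 * S ≤ D + 2 * ρ ^ 2 * (1 / ρ ^ 3) *
      ((m + L + L₁ * ρ ^ 2 * (1 / ρ ^ 3) * H) / σ + ρ ^ 4 / 2 * H + 1 / (2 * ρ ^ 4) * Q) +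
      L₁ * ρ ^ 4 * (1 / ρ ^ 3) ^ 2 * H) :
    S ≤ (|D| + 2 * ((|B| + L + L / b) / σ + 1 / 2 + V / σ) + L / b) * (ρ ^ 6 * H) * r ^ 3 := by
  have hρ0 : 0 < ρ := one_pos.trans_le hρ
  have hH0 : 0 < H := one_pos.trans_le hH
  have hpow : ∀ i ≤ 6, ρ ^ i ≤ ρ ^ 6 * H := fun i hi =>
    (pow_le_pow_right₀ hρ hi).trans (le_mul_of_one_le_right (by positivity) hH)
  have hpowH : ∀ i ≤ 6, ρ ^ i * H ≤ ρ ^ 6 * H := fun i hi =>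
    mul_le_mul_of_nonneg_right (pow_le_pow_right₀ hρ hi) hH0.le
  have h1 := mul_le_mul_of_nonneg_left h (by positivity : 0 ≤ ρ ^ 3 * r ^ 3)
  have e1 : ρ ^ 3 * r ^ 3 * (1 / ρ ^ 3 / r ^ 3 * S) = S := by field_simp
  have e2 : ρ ^ 3 * r ^ 3 * (D + 2 * ρ ^ 2 * (1 / ρ ^ 3) *
      ((m + L + L₁ * ρ ^ 2 * (1 / ρ ^ 3) * H) / σ + ρ ^ 4 / 2 * H + 1 / (2 * ρ ^ 4) * Q) +
      L₁ * ρ ^ 4 * (1 / ρ ^ 3) ^ 2 * H) = (D * ρ ^ 3 + 2 * ((m * ρ ^ 2 + L * ρ ^ 2 +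
      L₁ * (ρ * H)) / σ + 1 / 2 * (ρ ^ 6 * H) + Q / (2 * ρ ^ 2)) + L₁ * (ρ * H)) * r ^ 3 := by
    field_simp
  rw [e1, e2] at h1
  refine h1.trans (mul_le_mul_of_nonneg_right ?_ (by positivity))
  have tD : D * ρ ^ 3 ≤ |D| * (ρ ^ 6 * H) :=
    (mul_le_mul_of_nonneg_right (le_abs_self D) (by positivity)).trans
      (mul_le_mul_of_nonneg_left (hpow 3 (by norm_num)) (abs_nonneg D))
  have tm : m * ρ ^ 2 ≤ |B| * (ρ ^ 6 * H) := by
    calc m * ρ ^ 2 ≤ |B| * ρ ^ 4 * ρ ^ 2 := by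
          refine mul_le_mul_of_nonneg_right (hm.trans ?_) (by positivity)
          exact mul_le_mul_of_nonneg_right (le_abs_self B) (by positivity)
      _ = |B| * ρ ^ 6 := by ring
      _ ≤ _ := mul_le_mul_of_nonneg_left (hpow 6 le_rfl) (abs_nonneg B)
  have tL : L * ρ ^ 2 ≤ L * (ρ ^ 6 * H) := mul_le_mul_of_nonneg_left (hpow 2 (by norm_num)) hL
  have tL₁ : L₁ * (ρ * H) ≤ L / b * (ρ ^ 6 * H) := by
    calc L₁ * (ρ * H) ≤ L / b * ρ ^ 4 * (ρ * H) := mul_le_mul_of_nonneg_right hL₁ (by positivity)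
      _ = L / b * (ρ ^ 5 * H) := by ring
      _ ≤ _ := mul_le_mul_of_nonneg_left (hpowH 5 (by norm_num)) (by positivity)
  have tQ : Q / (2 * ρ ^ 2) ≤ V / σ * (ρ ^ 6 * H) := by
    rw [div_le_iff₀ (by positivity)]
    refine hQ.trans_eq ?_
    ring
  have tσ : (m * ρ ^ 2 + L * ρ ^ 2 + L₁ * (ρ * H)) / σ ≤ (|B| + L + L / b) / σ * (ρ ^ 6 * H) := by
    rw [div_mul_eq_mul_div]
    refine div_le_div_of_nonneg_right ?_ hσ.le
    linarith
  linarith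

/-- Since `C < K`, the number of indices is at least `(K + 1) / (C + 1)`, and `r³ / r⁴ = 1 / r`
leaves `K^{-1/4}`. -/
lemma average_le_of_sum_le {C K n : ℕ} (hK : 2 ≤ K) (hCK : C < K) {A S : ℝ} (hA : 0 ≤ A)
    (hS : S ≤ A * (((n : ℝ) ^ (1 / 4 : ℝ)) ^ 6 *
      ∑ k ∈ Finset.range (K + 1), 1 / ((k : ℝ) + 1)) * (((K : ℝ) + 1) ^ (1 / 4 : ℝ)) ^ 3) :
    ((K : ℝ) + 1 - C)⁻¹ * S ≤
      4 * (C + 1) * A * ((n : ℝ) ^ (3 / 2 : ℝ) * Real.log K / (K : ℝ) ^ (1 / 4 : ℝ)) := by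
  have hK' : (2 : ℝ) ≤ K := by exact_mod_cast hK
  have hCK' : (C : ℝ) < K := by exact_mod_cast hCK
  have hn : ((n : ℝ) ^ (1 / 4 : ℝ)) ^ 6 = (n : ℝ) ^ (3 / 2 : ℝ) := by
    rw [← rpow_div_four (by positivity)]
    norm_num
  rw [hn] at hS
  set N := (n : ℝ) ^ (3 / 2 : ℝ)
  have hN : 0 ≤ N := by positivity
  have hlog : 0 ≤ Real.log K := Real.log_nonneg (by linarith)
  set r := ((K : ℝ) + 1) ^ (1 / 4 : ℝ)
  have hr : 0 < r := by positivity
  have hr4 : r ^ 4 = (K : ℝ) + 1 := by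
    rw [← rpow_div_four (by positivity)]; norm_num
  have hκ : 0 < (K : ℝ) ^ (1 / 4 : ℝ) := by positivity
  have hκr : (K : ℝ) ^ (1 / 4 : ℝ) ≤ r :=
    Real.rpow_le_rpow (by positivity) (by linarith) (by norm_num)
  have hinv : ((K : ℝ) + 1 - C)⁻¹ ≤ (C + 1) / r ^ 4 := by
    rw [hr4, inv_le_iff_one_le_mul₀ (by linarith), div_mul_eq_mul_div, le_div_iff₀ (by positivity)]
    nlinarith [mul_nonneg (C.cast_nonneg (α := ℝ)) (sub_pos.2 hCK').le]
  calc ((K : ℝ) + 1 - C)⁻¹ * S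
      ≤ ((K : ℝ) + 1 - C)⁻¹ * (A * (N * (4 * Real.log K)) * r ^ 3) := by
        refine mul_le_mul_of_nonneg_left (hS.trans ?_) (inv_nonneg.2 (by linarith))
        have := sum_one_div_le_log hK
        gcongr
    _ ≤ (C + 1) / r ^ 4 * (A * (N * (4 * Real.log K)) * r ^ 3) :=
        mul_le_mul_of_nonneg_right hinv (by positivity)
    _ = 4 * (C + 1) * A * (N * Real.log K / r) := by field_simp
    _ ≤ _ := by gcongr

end Rate

end ZOSignum
end

/-! ### Assembly of the bound -/

theorem mainTheorem2 (L₀ : ℝ≥0) (D B b σ : ℝ) (hb : 0 < b) (hσ : 0 < σ) (C : ℕ) :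
    ∃ A : ℝ, 0 < A ∧
      ∀ (n q : ℕ), 1 ≤ n → 1 ≤ q →
      -- the blackbox
      ∀ (Ξ : Type*) [MeasurableSpace Ξ] (ν : Measure Ξ) [IsProbabilityMeasure ν]
        (F : EuclideanSpace ℝ (Fin n) → Ξ → ℝ),
      (∀ x, Measurable (F x)) → (∀ x, Integrable (F x) ν) →
      (∀ ξ, LipschitzWith L₀ fun x => F x ξ) →
      -- the smoothing parameter and the initial momentum step size, both of order one
      ∀ (β s₂ : ℝ), b ≤ β → σ ≤ s₂ → s₂ ≤ 1 →
      -- the random inputs of the algorithm and the samples it draws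
      ∀ (Ω : Type*) [MeasurableSpace Ω] (P : Measure Ω) [IsProbabilityMeasure P]
        (x₀ m₀ : Ω → EuclideanSpace ℝ (Fin n))
        (u : ℕ → Fin q → Ω → EuclideanSpace ℝ (Fin n)) (ξ : ℕ → Fin q → Ω → Ξ),
      Measurable x₀ → Measurable m₀ → (∀ k j, Measurable (u k j)) → (∀ k j, Measurable (ξ k j)) →
      (∀ k j, HasLaw (fun ω => (u k j ω, ξ k j ω))
        ((stdGaussian (EuclideanSpace ℝ (Fin n))).prod ν) P) →
      iIndepFun (fun (p : ℕ × Fin q) ω => (u p.1 p.2 ω, ξ p.1 p.2 ω)) P →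
      IndepFun (fun ω => (x₀ ω, m₀ ω))
        (fun ω (p : ℕ × Fin q) => (u p.1 p.2 ω, ξ p.1 p.2 ω)) P →
      Integrable m₀ P → ∫ ω, ‖m₀ ω‖ ∂P ≤ B * n →
      ∀ (fβ : EuclideanSpace ℝ (Fin n) → ℝ) (x : ℕ → Ω → EuclideanSpace ℝ (Fin n)),
      fβ = ZOSignum.smoothing (ZOSignum.objective ν F) β →
      x = (fun k ω => (ZOSignum.iterate F β
        (ZOSignum.stepSize ((n : ℝ) ^ (-(3 / 4) : ℝ)) (3 / 4)) (ZOSignum.stepSize s₂ (1 / 2))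
        (x₀ ω) (m₀ ω) (fun k j => u k j ω) (fun k j => ξ k j ω) k).1) →
      -- the initial gap `f^β(x^C) - inf f^β` is at most `D`
      (∀ᵐ ω ∂P, ∀ y, fβ (x C ω) - fβ y ≤ D) →
      ∀ (K : ℕ), 2 ≤ K → C < K →
      -- the uniformly random index in `{C, …, K}`
      ∀ (R : Ω → ℕ), Measurable R → HasLaw R (uniformOn (Set.Icc C K)) P →
      IndepFun R (fun ω => ((x₀ ω, m₀ ω),
        fun (p : ℕ × Fin q) => (u p.1 p.2 ω, ξ p.1 p.2 ω))) P →
      Differentiable ℝ fβ ∧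
      Integrable (fun ω => ‖∇ fβ (x (R ω) ω)‖) P ∧
      ∫ ω, ‖∇ fβ (x (R ω) ω)‖ ∂P ≤
        A * ((n : ℝ) ^ (3 / 2 : ℝ) * Real.log K / (K : ℝ) ^ (1 / 4 : ℝ)) := by
  set V : ℝ := 2 * L₀ ^ 2 * ((∫ x, x ^ 4 ∂(gaussianReal 0 1)) + 1) with hV
  have hc4 : 0 ≤ ∫ x : ℝ, x ^ 4 ∂(gaussianReal 0 1) :=
    integral_nonneg fun x => by positivity
  have hV0 : 0 ≤ V := by positivity
  -- The constant of `sum_le_of_scaled_bound`; the `1 / 2` from Young's inequality keeps it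
  -- positive.
  set A : ℝ := |D| + 2 * ((|B| + L₀ + L₀ / b) / σ + 1 / 2 + V / σ) + L₀ / b with hA
  have hA0 : 0 < A := by positivity
  refine ⟨4 * (C + 1) * A, by positivity, ?_⟩
  intro n q hn hq Ξ _ ν _ F hFm hFi hFL β s₂ hbβ hσs hs₂ Ω _ P _ x₀ m₀ u ξ hx₀ hm₀ hu hξ hlaw
    hiid hind hm₀i hm₀B fβ x hfβ hx hD K hK hCK R hR hRlaw hRind
  have hβ : 0 < β := hb.trans_le hbβ
  have hn' : (1 : ℝ) ≤ n := by exact_mod_cast hn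
  have hLip := ZOSignum.lipschitzWith_objective hFi hFL
  have hdiff : Differentiable ℝ fβ := hfβ ▸ ZOSignum.differentiable_smoothing hLip hβ.ne'
  have hcont : Continuous (∇ fβ) := hfβ ▸ ZOSignum.continuous_gradient_smoothing hn hLip hβ
  have hbdd : ∀ y, ‖∇ fβ y‖ ≤ L₀ := hfβ ▸ ZOSignum.norm_gradient_smoothing_le hLip β
  set ρ : ℝ := (n : ℝ) ^ (1 / 4 : ℝ) with hρ
  have hρ1 : 1 ≤ ρ := Real.one_le_rpow hn' (by norm_num)
  have hρ0 : 0 < ρ := one_pos.trans_le hρ1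
  have hρ4 : (n : ℝ) = ρ ^ 4 := by
    rw [hρ, ← ZOSignum.rpow_div_four (by positivity)]; norm_num
  have hρ2 : √(n : ℝ) = ρ ^ 2 := by
    rw [hρ4, show ρ ^ 4 = (ρ ^ 2) ^ 2 by ring, Real.sqrt_sq (by positivity)]
  have hρt : (n : ℝ) ^ (-(3 / 4) : ℝ) = 1 / ρ ^ 3 := by
    rw [Real.rpow_neg (by positivity), hρ, ← ZOSignum.rpow_div_four (by positivity)]; norm_num
  set s₁' := ZOSignum.stepSize ((n : ℝ) ^ (-(3 / 4) : ℝ)) (3 / 4) with hs₁'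
  set s₂' := ZOSignum.stepSize s₂ (1 / 2) with hs₂'
  set r : ℕ → ℝ := fun k => ((k : ℝ) + 1) ^ (1 / 4 : ℝ) with hr
  have hr1 : ∀ k, 1 ≤ r k := fun k =>
    Real.one_le_rpow (by linarith [k.cast_nonneg (α := ℝ)]) (by norm_num)
  have hr0 : ∀ k, 0 < r k := fun k => one_pos.trans_le (hr1 k)
  have hrmono : Monotone r := fun i j hij => by
    refine Real.rpow_le_rpow (by positivity) ?_ (by norm_num)
    have : (i : ℝ) ≤ j := by exact_mod_cast hij
    linarith
  have hr4 : ∀ k, r k ^ 4 = (k : ℝ) + 1 := fun k => by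
    simp only [hr]; rw [← ZOSignum.rpow_div_four (by positivity)]; norm_num
  have hs₁r : ∀ k, s₁' k = (1 / ρ ^ 3) / r k ^ 3 := fun k => by
    rw [hs₁', ZOSignum.stepSize_three_quarters, hρt]
  have hs₂r : ∀ k, s₂' k = s₂ / r k ^ 2 := fun k => by
    rw [hs₂', ZOSignum.stepSize_half]
  have hs₂0 : ∀ k, 0 ≤ s₂' k := fun k => by
    rw [hs₂r]; exact div_nonneg (hσ.le.trans hσs) (pow_pos (hr0 k) 2).le
  have hs₂1 : ∀ k, s₂' k ≤ 1 := fun k => by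
    rw [hs₂r]
    exact div_le_one_of_le₀ (hs₂.trans (one_le_pow₀ (hr1 k))) (pow_pos (hr0 k) 2).le
  set H := ∑ k ∈ Finset.range (K + 1), 1 / ((k : ℝ) + 1) with hH
  have hHr : H = ∑ k ∈ Finset.range (K + 1), 1 / r k ^ 4 := by simp only [hH, hr4]
  have hH1 : 1 ≤ H := by
    have := Finset.single_le_sum (f := fun k : ℕ => 1 / ((k : ℝ) + 1))
      (fun k _ => by positivity) (Finset.mem_range.2 K.succ_pos)
    simpa [hH] using this
  set M : ℕ → Ω → EuclideanSpace ℝ (Fin n) := fun k ω =>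
    ZOSignum.momentumNoise F β s₁' s₂' (∇ (ZOSignum.smoothing (ZOSignum.objective ν F) β))
      (x₀ ω) (m₀ ω) (fun k j => u k j ω) (fun k j => ξ k j ω) k with hM
  have hnoise := ZOSignum.integral_sq_norm_momentumNoise_succ_le hn hq hFm hFi hFL hβ hs₂0 hs₂1
    hx₀ hm₀ hu hξ hlaw hiid hind hM
  have hMInt : ∀ k, Integrable (fun ω => ‖M k ω‖ ^ 2) P := fun k =>
    (hnoise k).1.integrable_norm_pow (by norm_num)
  have hQ : ∑ k ∈ Finset.range (K + 1), 1 / r k ^ 2 * ∫ ω, ‖M (k + 1) ω‖ ^ 2 ∂P ≤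
      2 * V * ρ ^ 8 / σ * H := by
    have h1 := ZOSignum.sum_mul_succ_le_of_contraction (a := fun k => ∫ ω, ‖M k ω‖ ^ 2 ∂P)
      (V := V * n ^ 2) (fun k => integral_nonneg fun ω => sq_nonneg _) hs₂0 hs₂1 (by positivity)
      (fun k => (hnoise k).2.trans_eq (by rw [hV]; ring)) (K + 1)
    have h0 : ∫ ω, ‖M 0 ω‖ ^ 2 ∂P = 0 := by simp [hM, ZOSignum.momentumNoise]
    have h2 : ∑ k ∈ Finset.range (K + 1), s₂' k ^ 2 ≤ H := by
      rw [hHr]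
      refine Finset.sum_le_sum fun k _ => ?_
      rw [hs₂r, div_pow, ← pow_mul]
      exact div_le_div_of_nonneg_right (pow_le_one₀ (hσ.le.trans hσs) hs₂) (pow_pos (hr0 k) 4).le
    have h3 : σ * ∑ k ∈ Finset.range (K + 1), 1 / r k ^ 2 * ∫ ω, ‖M (k + 1) ω‖ ^ 2 ∂P ≤
        ∑ k ∈ Finset.range (K + 1), s₂' k * ∫ ω, ‖M (k + 1) ω‖ ^ 2 ∂P := by
      rw [Finset.mul_sum]
      refine Finset.sum_le_sum fun k _ => ?_
      rw [← mul_assoc]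
      refine mul_le_mul_of_nonneg_right ?_ (integral_nonneg fun ω => sq_nonneg _)
      rw [hs₂r, mul_one_div]
      exact div_le_div_of_nonneg_right hσs (pow_pos (hr0 k) 2).le
    rw [div_mul_eq_mul_div, le_div_iff₀ hσ, mul_comm _ σ]
    calc _ ≤ 0 + 2 * (V * n ^ 2) * H := by
          refine h3.trans (h1.trans (add_le_add h0.le ?_))
          exact mul_le_mul_of_nonneg_left h2 (by positivity)
      _ = 2 * V * ρ ^ 8 * H := by rw [hρ4]; ring
  have hL₁ : L₀ * n / β ≤ L₀ / b * ρ ^ 4 := by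
    rw [← hρ4, mul_div_right_comm]
    gcongr
  have hxm : ∀ k, Measurable (x k) := fun k => by
    have := ZOSignum.measurable_augmentedIterate hFm hFL β s₁' s₂' hcont.measurable hx₀ hm₀
      (w := fun ω k j => (u k j ω, ξ k j ω)) (by fun_prop) k
    rw [hx]
    exact measurable_fst.comp (measurable_fst.comp this)
  have hhInt : ∀ k, Integrable (fun ω => ‖∇ fβ (x k ω)‖) P := fun k =>
    (integrable_const (L₀ : ℝ)).mono' (hcont.measurable.comp (hxm k)).norm.aestronglyMeasurable
      (.of_forall fun ω => by rw [norm_norm]; exact hbdd _)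
  have hpath : ∀ᵐ ω ∂P, 1 / ρ ^ 3 / r K ^ 3 * ∑ k ∈ Finset.Icc C K, ‖∇ fβ (x k ω)‖ ≤
      D + 2 * ρ ^ 2 * (1 / ρ ^ 3) *
        ((‖m₀ ω‖ + L₀ + L₀ * n / β * ρ ^ 2 * (1 / ρ ^ 3) * H) / σ + ρ ^ 4 / 2 * H +
        1 / (2 * ρ ^ 4) * ∑ k ∈ Finset.range (K + 1), 1 / r k ^ 2 * ‖M (k + 1) ω‖ ^ 2) +
        L₀ * n / β * ρ ^ 4 * (1 / ρ ^ 3) ^ 2 * H := by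
    filter_upwards [hD] with ω hDω
    have h := ZOSignum.mul_sum_norm_le_of_signum (φ := fβ) (h := ∇ fβ) (L := L₀)
      (L₁ := L₀ * n / β) (t := 1 / ρ ^ 3) (σ := σ) (s₂ := s₂) (D := D) hn (by positivity) hσ hσs
      hs₂ (by positivity) hbdd (hfβ ▸ ZOSignum.norm_gradient_smoothing_sub_le hn hLip hβ)
      (hfβ ▸ ZOSignum.smoothing_le_add_inner hn hLip hβ) hr1 hrmono
      (x := fun k => x k ω)
      (m := fun k => (ZOSignum.iterate F β s₁' s₂' (x₀ ω) (m₀ ω) (fun k j => u k j ω)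
        (fun k j => ξ k j ω) k).2) (M := fun k => M k ω)
      (g := fun k => ZOSignum.gradEstimate F β (x k ω) (fun j => u k j ω) (fun j => ξ k j ω))
      (fun k => by rw [← hs₂r, hx]; rfl) (fun k => by rw [← hs₁r, hx]; rfl) rfl
      (fun k => by rw [← hs₂r, hx, hfβ]; rfl) hCK.le hDω
    rw [hρ2, ← hHr, hρ4] at h
    rw [hρ4]
    exact h
  have hmain : 1 / ρ ^ 3 / r K ^ 3 * ∑ k ∈ Finset.Icc C K, ∫ ω, ‖∇ fβ (x k ω)‖ ∂P ≤
      D + 2 * ρ ^ 2 * (1 / ρ ^ 3) *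
        (((∫ ω, ‖m₀ ω‖ ∂P) + L₀ + L₀ * n / β * ρ ^ 2 * (1 / ρ ^ 3) * H) / σ + ρ ^ 4 / 2 * H +
        1 / (2 * ρ ^ 4) * ∑ k ∈ Finset.range (K + 1), 1 / r k ^ 2 * ∫ ω, ‖M (k + 1) ω‖ ^ 2 ∂P) +
        L₀ * n / β * ρ ^ 4 * (1 / ρ ^ 3) ^ 2 * H := by
    have i1 : Integrable (fun ω => (‖m₀ ω‖ + L₀ + L₀ * n / β * ρ ^ 2 * (1 / ρ ^ 3) * H) / σ) P :=
      ((hm₀i.norm.add (integrable_const _)).add (integrable_const _)).div_const _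
    have i2 : ∀ k ∈ Finset.range (K + 1),
        Integrable (fun ω => 1 / r k ^ 2 * ‖M (k + 1) ω‖ ^ 2) P := fun k _ =>
      (hMInt (k + 1)).const_mul _
    have i3 := (integrable_finsetSum _ i2).const_mul (1 / (2 * ρ ^ 4))
    have i4 := (i1.fun_add (integrable_const (ρ ^ 4 / 2 * H))).fun_add i3
    have i5 := (integrable_const (μ := P) D).fun_add (i4.const_mul (2 * ρ ^ 2 * (1 / ρ ^ 3)))
    have i6 := i5.fun_add (integrable_const (L₀ * n / β * ρ ^ 4 * (1 / ρ ^ 3) ^ 2 * H))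
    have := integral_mono_ae
      ((integrable_finsetSum _ fun k (_ : k ∈ Finset.Icc C K) => hhInt k).const_mul _) i6 hpath
    rw [integral_const_mul, integral_finsetSum _ fun k _ => hhInt k,
      integral_add i5 (integrable_const _), integral_add (integrable_const _) (i4.const_mul _),
      integral_const_mul, integral_add (i1.fun_add (integrable_const _)) i3,
      integral_add i1 (integrable_const _), integral_const_mul (1 / (2 * ρ ^ 4)),
      integral_finsetSum _ i2,
      integral_div, integral_add (hm₀i.norm.fun_add (integrable_const _)) (integrable_const _),
      integral_add hm₀i.norm (integrable_const _)] at this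
    simpa only [integral_const, probReal_univ, one_smul, integral_const_mul] using this
  have hsum := ZOSignum.sum_le_of_scaled_bound hρ1 hH1 (hr0 K) L₀.coe_nonneg hb hσ
    (hm₀B.trans_eq (by rw [hρ4])) hL₁ hQ hmain
  -- Each gradient norm is a measurable function, bounded by `L₀`, of the initial data and the
  -- samples, which are independent of `R`.
  have hR' := ZOSignum.integral_comp_uniformIndex (P := P) hCK.le hR hRlaw
    (Z := fun ω => ((x₀ ω, m₀ ω), fun (p : ℕ × Fin q) => (u p.1 p.2 ω, ξ p.1 p.2 ω)))
    (Φ := fun k z => ‖∇ fβ (ZOSignum.iterate F β s₁' s₂' z.1.1 z.1.2 (fun k j => (z.2 (k, j)).1)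
      (fun k j => (z.2 (k, j)).2) k).1‖) (by fun_prop)
    (fun k => by
      have := ZOSignum.measurable_augmentedIterate hFm hFL β s₁' s₂' hcont.measurable
        (α := (EuclideanSpace ℝ (Fin n) × EuclideanSpace ℝ (Fin n)) ×
          (ℕ × Fin q → EuclideanSpace ℝ (Fin n) × Ξ))
        (x₀ := fun z => z.1.1) (m₀ := fun z => z.1.2) (w := fun z k j => z.2 (k, j))
        (by fun_prop) (by fun_prop) (by fun_prop) k
      exact (hcont.measurable.comp (measurable_fst.comp (measurable_fst.comp this))).norm)
    (c := L₀) (fun k z => by rw [abs_norm]; exact hbdd _) hRind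
  subst hx
  refine ⟨hdiff, hR'.1, ?_⟩
  refine hR'.2.trans_le ?_
  exact ZOSignum.average_le_of_sum_le hK hCK hA0.le hsum
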